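/- Let $\mathcal S_0,\mathcal S,\mathcal U,\mathcal V$ be finite sets, let $Q_{S_0,S,U,V}$ be a probability mass function (PMF) on $\mathcal S_0\times\mathcal S\times\mathcal U\times\mathcal V$, and let $\tilde R,R'\ge 0$. Logarithms in informations and relative entropies are to base $2$, and $Q^n$ denotes $n$-fold products of PMFs and of conditional PMFs (a conditional PMF given an event of probability zero is taken uniform). For $n\in\mathbb N$ let $\mathcal W=\{1,\dots,\lfloor 2^{n\tilde R}\rfloor\}$ and $\mathcal I=\{1,\dots,\lfloor 2^{nR'}\rfloor\}$. Random codebook $\mathbb B_n$: for all $\mathbf s_0\in\mathcal S_0^n$, $w\in\mathcal W$, $i\in\mathcal I$, the codewords $\mathbf U(\mathbf s_0,w,i)\in\mathcal U^n$ are independent with $\mathbf U(\mathbf s_0,w,i)\sim Q^n_{U|S_0=\mathbf s_0}$. A realization is denoted $\mathcal B_n=\{\mathbf u(\mathbf s_0,w,i)\}$. Likelihood encoder: $$\hat P^{(\mathcal B_n)}(i|w,\mathbf s_0,\mathbf s)=\frac{Q^n_{S|U,S_0}(\mathbf s|\mathbf u(\mathbf s_0,w,i),\mathbf s_0)}{\sum_{i'\in\mathcal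 I}Q^n_{S|U,S_0}(\mathbf s|\mathbf u(\mathbf s_0,w,i'),\mathbf s_0)}.$$ Induced output law: $W$ is uniform on $\mathcal W$ and independent of $(\mathbf S_0,\mathbf S)\sim Q^n_{S_0,S}$, the index $I$ is drawn from $\hat P^{(\mathcal B_n)}(\cdot|W,\mathbf S_0,\mathbf S)$, and $\mathbf u(\mathbf S_0,W,I)$ is sent through $Q^n_{V|U,S_0,S}$, that is, $$P^{(\mathcal B_n)}(\mathbf v|\mathbf s_0,\mathbf s)=\frac1{|\mathcal W|}\sum_{w\in\mathcal W}\Big[\sum_{i\in\mathcal I}\hat P^{(\mathcal B_n)}(i|w,\mathbf s_0,\mathbf s)\,Q^n_{V|U,S_0,S}(\mathbf v|\mathbf u(\mathbf s_0,w,i),\mathbf s_0,\mathbf s)\Big],$$ where, for those $w$ for which the denominator of $\hat P^{(\mathcal B_n)}(\cdot|w,\mathbf s_0,\mathbf s)$ vanishes, the bracket is replaced by $F^{(\mathcal B_n)}(\mathbf v|w,\mathbf s_0,\mathbf s)$. Here the completion $F^{(\mathcal B_n)}(\cdot|w,\mathbf s_0,\mathbf s)$ is any non-negative function on $\mathcal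 V^n$ of total mass at most one ($F=0$ is the convention $0/0=0$; mass one makes $P^{(\mathcal B_n)}(\cdot|\mathbf s_0,\mathbf s)$ a PMF). Claim: suppose that $$R'>I(U;S|S_0),\qquad R'+\tilde R>I(U;S,V|S_0).$$ Then there is $c>0$, independent of the completion, such that for every completion $F$ the following hold. (1) For all sufficiently large $n$, $$\mathbb E_{\mathbb B_n}\Big\|Q^n_{S_0,S}P^{(\mathbb B_n)}_{\mathbf V|\mathbf S_0,\mathbf S}-Q^n_{S_0,S,V}\Big\|_{\mathrm{TV}}\le e^{-cn},\qquad \|P-Q\|_{\mathrm{TV}}=\tfrac12\sum_x|P(x)-Q(x)|.$$ (2) Suppose in addition that $F$ is supported in the target, i.e. $F^{(\mathcal B_n)}(\mathbf v|w,\mathbf s_0,\mathbf s)=0$ whenever $Q^n_{S_0,S}(\mathbf s_0,\mathbf s)>0$ and $Q^n_{V|S_0,S}(\mathbf v|\mathbf s_0,\mathbf s)=0$ (for example $F=0$ or $F=Q^n_{V|S_0,S}$). Then for every codebook $\mathcal B_n$ of positive probability and all $(\mathbf s_0,\mathbf s)$ with $Q^n_{S_0,S}(\mathbf s_0,\mathbf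 s)>0$, the law $P^{(\mathcal B_n)}(\cdot|\mathbf s_0,\mathbf s)$ is absolutely continuous with respect to $Q^n_{V|S_0,S}(\cdot|\mathbf s_0,\mathbf s)$, and $$\mathbb E_{\mathbb B_n}D\Big(P^{(\mathbb B_n)}_{\mathbf V|\mathbf S_0,\mathbf S}\Big\|Q^n_{V|S_0,S}\Big|Q^n_{S_0,S}\Big):=\mathbb E_{\mathbb B_n}\sum_{\mathbf s_0,\mathbf s}Q^n_{S_0,S}(\mathbf s_0,\mathbf s)\sum_{\mathbf v}P^{(\mathbb B_n)}(\mathbf v|\mathbf s_0,\mathbf s)\log\frac{P^{(\mathbb B_n)}(\mathbf v|\mathbf s_0,\mathbf s)}{Q^n_{V|S_0,S}(\mathbf v|\mathbf s_0,\mathbf s)}\xrightarrow[n\to\infty]{}0;$$ moreover its absolute value is at most $e^{-cn}$ for all sufficiently large $n$. -/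

import Mathlib

open Filter Topology

namespace SoftCovering

noncomputable section

/-! Probability mass functions on a finite type are real functions in `stdSimplex`. -/

/-- Conditional PMF of the second argument given the first one, for a joint PMF `J`.
Every row is a PMF: rows of probability zero are uniform, by convention. -/
def condPMF {X Y : Type*} [Fintype Y] (J : X → Y → ℝ) (x : X) (y : Y) : ℝ :=
  open Classical in
  if ∑ y', J x y' = 0 then (Fintype.card Y : ℝ)⁻¹ else J x y / ∑ y', J x y'

/-- The `n`-fold product PMF `p^n`. -/
def prodPMF {X : Type*} {n : ℕ} (p : X → ℝ) (x : Fin n → X) : ℝ :=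
  ∏ t, p (x t)

/-- The `n`-fold product (memoryless) kernel `K^n(y | x)`. -/
def prodKernel {X Y : Type*} {n : ℕ} (K : X → Y → ℝ) (x : Fin n → X) (y : Fin n → Y) : ℝ :=
  ∏ t, K (x t) (y t)

/-- Total variation `(1/2) ∑ |P - Q|`. -/
def tvDist {X : Type*} [Fintype X] (P Q : X → ℝ) : ℝ :=
  (1 / 2) * ∑ x, |P x - Q x|

/-- Relative entropy (in bits) `∑ P log (P / Q)`. Terms with `P x = 0` vanish; the
formula is meaningful when `P` is absolutely continuous with respect to `Q`. -/
def relEntropy {X : Type*} [Fintype X] (P Q : X → ℝ) : ℝ :=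
  ∑ x, P x * Real.logb 2 (P x / Q x)

/-- Conditional mutual information (in bits) `I(X; Y | Z)` of a joint PMF `J z x y`. -/
def condMutualInfo {Z X Y : Type*} [Fintype Z] [Fintype X] [Fintype Y]
    (J : Z → X → Y → ℝ) : ℝ :=
  ∑ z, ∑ x, ∑ y, J z x y *
    Real.logb 2 ((J z x y * ∑ x', ∑ y', J z x' y') / ((∑ y', J z x y') * ∑ x', J z x' y))

section Single

variable {S₀ S U V : Type*} [Fintype S₀] [Fintype S] [Fintype U] [Fintype V]

/-- The marginal `Q_{S₀,S}`. -/
def margS₀S (Q : S₀ × S × U × V → ℝ) (x : S₀ × S) : ℝ :=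
  ∑ u, ∑ v, Q (x.1, x.2, u, v)

/-- The marginal `Q_{S₀,S,V}`. -/
def margS₀SV (Q : S₀ × S × U × V → ℝ) (x : S₀ × S × V) : ℝ :=
  ∑ u, Q (x.1, x.2.1, u, x.2.2)

/-- `Q_{U|S₀}`. -/
def kerU (Q : S₀ × S × U × V → ℝ) : S₀ → U → ℝ :=
  condPMF fun s₀ u => ∑ s, ∑ v, Q (s₀, s, u, v)

/-- `Q_{S|U,S₀}`. -/
def kerS (Q : S₀ × S × U × V → ℝ) : U × S₀ → S → ℝ :=
  condPMF fun x s => ∑ v, Q (x.2, s, x.1, v)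

/-- `Q_{V|U,S₀,S}`. -/
def kerV (Q : S₀ × S × U × V → ℝ) : U × S₀ × S → V → ℝ :=
  condPMF fun x v => Q (x.2.1, x.2.2, x.1, v)

/-- `Q_{V|S₀,S}`. -/
def targetV (Q : S₀ × S × U × V → ℝ) : S₀ × S → V → ℝ :=
  condPMF fun x v => ∑ u, Q (x.1, x.2, u, v)

/-- `I(U; S | S₀)`. -/
def infoUS (Q : S₀ × S × U × V → ℝ) : ℝ :=
  condMutualInfo fun (s₀ : S₀) (u : U) (s : S) => ∑ v, Q (s₀, s, u, v)

/-- `I(U; S, V | S₀)`. -/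
def infoUSV (Q : S₀ × S × U × V → ℝ) : ℝ :=
  condMutualInfo fun (s₀ : S₀) (u : U) (y : S × V) => Q (s₀, y.1, u, y.2)

end Single

/-- The number of indices in `[1 : 2^{nR}]`. -/
def numIdx (n : ℕ) (R : ℝ) : ℕ := ⌊(2 : ℝ) ^ ((n : ℝ) * R)⌋₊

/-- A codebook: for every state sequence `s₀`, message `w` and index `i` a codeword
`u(s₀, w, i)`, with `M` messages and `K` indices. -/
abbrev Codebook (S₀ U : Type*) (n M K : ℕ) : Type _ :=
  (Fin n → S₀) → Fin M → Fin K → (Fin n → U)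

section Coding

variable {S₀ S U V : Type*} [Fintype S₀] [Fintype S] [Fintype U] [Fintype V] {n M K : ℕ}

/-- Law of the random codebook: all codewords independent, `U(s₀, w, i) ∼ Q^n_{U|S₀=s₀}`. -/
def codebookLaw [DecidableEq S₀] (Q : S₀ × S × U × V → ℝ) (B : Codebook S₀ U n M K) : ℝ :=
  ∏ s₀, ∏ w, ∏ i, prodKernel (kerU Q) s₀ (B s₀ w i)

/-- Expectation over the random codebook. -/
def codebookExp [DecidableEq S₀] (Q : S₀ × S × U × V → ℝ) (f : Codebook S₀ U n M K → ℝ) : ℝ :=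
  ∑ B, codebookLaw Q B * f B

/-- The likelihood `Q^n_{S|U,S₀}(s | u(s₀, w, i), s₀)`. -/
def likelihood (Q : S₀ × S × U × V → ℝ) (B : Codebook S₀ U n M K)
    (s₀ : Fin n → S₀) (s : Fin n → S) (w : Fin M) (i : Fin K) : ℝ :=
  prodKernel (kerS Q) (fun t => (B s₀ w i t, s₀ t)) s

/-- The likelihood encoder. The value is `0` if all the likelihoods of bin `w` vanish. -/
def likEncoder (Q : S₀ × S × U × V → ℝ) (B : Codebook S₀ U n M K)
    (s₀ : Fin n → S₀) (s : Fin n → S) (w : Fin M) (i : Fin K) : ℝ :=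
  likelihood Q B s₀ s w i / ∑ i', likelihood Q B s₀ s w i'

/-- The law of the output `v` given `(s₀, s)` induced by the codebook `B`: `w` is uniform,
`i` is drawn by the likelihood encoder, and the codeword `u(s₀, w, i)` is sent through
`Q^n_{V|U,S₀,S}`. If all the likelihoods of bin `w` vanish, the encoder is undefined (`0/0`) and
the output is described by the (sub-)PMF `F w s₀ s` instead. -/
def outputLaw (Q : S₀ × S × U × V → ℝ) (B : Codebook S₀ U n M K)
    (F : Fin M → (Fin n → S₀) → (Fin n → S) → (Fin n → V) → ℝ)
    (s₀ : Fin n → S₀) (s : Fin n → S) (v : Fin n → V) : ℝ :=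
  open Classical in
  ∑ w, (M : ℝ)⁻¹ *
    ((∑ i, likEncoder Q B s₀ s w i *
        prodKernel (kerV Q) (fun t => (B s₀ w i t, s₀ t, s t)) v)
      + if ∑ i, likelihood Q B s₀ s w i = 0 then F w s₀ s v else 0)

/-- The conditional relative entropy `D(P_{V|S₀,S} ‖ Q^n_{V|S₀,S} | Q^n_{S₀,S})`, for a
conditional law `P` of the output sequence. -/
def condRelEntropy (Q : S₀ × S × U × V → ℝ)
    (P : (Fin n → S₀) → (Fin n → S) → (Fin n → V) → ℝ) : ℝ :=
  ∑ s₀ : Fin n → S₀, ∑ s : Fin n → S, prodPMF (margS₀S Q) (fun t => (s₀ t, s t)) *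
    relEntropy (P s₀ s) (prodKernel (targetV Q) (fun t => (s₀ t, s t)))

/-- The total variation between `Q^n_{S₀,S} P_{V|S₀,S}` and `Q^n_{S₀,S,V}`. -/
def jointTV (Q : S₀ × S × U × V → ℝ)
    (P : (Fin n → S₀) → (Fin n → S) → (Fin n → V) → ℝ) : ℝ :=
  tvDist
    (fun x : (Fin n → S₀) × (Fin n → S) × (Fin n → V) =>
      prodPMF (margS₀S Q) (fun t => (x.1 t, x.2.1 t)) * P x.1 x.2.1 x.2.2)
    (fun x => prodPMF (margS₀SV Q) (fun t => (x.1 t, x.2.1 t, x.2.2 t)))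

end Coding

/-- A completion of the likelihood encoder at the places where it is undefined: for every
blocklength and codebook, a sub-PMF of output sequences for each `(w, s₀, s)`. The zero
completion is the convention `0/0 = 0`. -/
def IsCompletion {S₀ S U V : Type*} [Fintype V] (Rt R' : ℝ)
    (F : ∀ n : ℕ, Codebook S₀ U n (numIdx n Rt) (numIdx n R') →
      Fin (numIdx n Rt) → (Fin n → S₀) → (Fin n → S) → (Fin n → V) → ℝ) : Prop :=
  ∀ n B w s₀ s, (∀ v, 0 ≤ F n B w s₀ s v) ∧ ∑ v, F n B w s₀ s v ≤ 1

end

end SoftCovering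

/-! The likelihood encoder is a Bayes posterior. For fixed `s₀` and message `w`, pick an index
uniformly and send its codeword through `Q_{S,V|U,S₀}`; let `Γ_w(s)` be the resulting law of `s`.
Given `s`, the index then has exactly the encoder's law, so `Γ_w(s)` times the message output law is
the bin average of `Q^n_{S,V|U,S₀}` (`sum_likelihood_mul_messageLaw`). With `q₁`, `q₂` the product
laws of `s` and of `(s, v)` given `s₀`, and `m_w` the message output law, `q₁ P - q₂ = avg_w (q₁ -
Γ_w) m_w + (avg_w Γ_w m_w - q₂)`. The first term asks the `2^{nR'}` words of a bin to cover `S`, the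
second asks all `2^{n(R' + Rt)}` words of a row to cover `(S, V)`; these are the two rate conditions
(`two_mul_jointTV_le`). The completion enters only where `Γ_w = 0` and has mass at most one, so the
bound does not depend on it.

Both terms are instances of soft covering, `IsChain.exists_covering_rate`. At each output sequence
the likelihoods are truncated at `exp(nθ)` times their mean: the bounded part concentrates by a
variance computation, and the excess has exponentially small mean by a Chernoff bound on the
information density (`expected_deviation_le`, `IsChain.tail_le`).

Relative entropy follows from total variation because the log of a positive target probability is at
least `-n * logBound Q`: the loss is a factor linear in `n` (`abs_condRelEntropy_le`), absorbed by
giving up half of the exponent. -/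

namespace SoftCovering

set_option linter.unusedSectionVars false

/-! ### Moments under product laws and one-shot soft covering. -/

section Product

variable {ι A : Type*} [Fintype ι] [DecidableEq ι] [Fintype A]

/-- Sums of products over a function space factor. -/
lemma sum_pi_prod (f : ι → A → ℝ) :
    ∑ x : ι → A, ∏ t, f t (x t) = ∏ t, ∑ a, f t a := by
  rw [Finset.prod_univ_sum, Fintype.piFinset_univ]

lemma sum_pi_prod_eq_one {P : ι → A → ℝ} (hP : ∀ t, ∑ a, P t a = 1) :
    ∑ x : ι → A, ∏ t, P t (x t) = 1 := by
  rw [sum_pi_prod]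
  simp [hP]

/-- Marginals of a product law. -/
lemma sum_pi_prod_mul_eval {P : ι → A → ℝ} (hP : ∀ t, ∑ a, P t a = 1) (i : ι) (g : A → ℝ) :
    ∑ x : ι → A, (∏ t, P t (x t)) * g (x i) = ∑ a, P i a * g a := by
  -- Writing `g (x i)` as a product over all coordinates, trivial off `i`, lets the sum factorize.
  have h : ∀ x : ι → A, (∏ t, P t (x t)) * g (x i)
      = ∏ t, P t (x t) * (if t = i then g (x t) else 1) := by
    intro x
    rw [Finset.prod_mul_distrib, Finset.prod_ite_eq' Finset.univ i]
    simp
  simp_rw [h]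
  rw [sum_pi_prod fun t a => P t a * (if t = i then g a else 1),
    Finset.prod_eq_single i]
  · simp
  · intro t _ ht
    simp [ht, hP]
  · simp

/-- Distinct coordinates of a product law are uncorrelated. -/
lemma sum_pi_prod_mul_eval_mul_eval {P : ι → A → ℝ} {i j : ι} (hij : i ≠ j) {g h : A → ℝ}
    (hg : ∑ a, P i a * g a = 0) :
    ∑ x : ι → A, (∏ t, P t (x t)) * (g (x i) * h (x j)) = 0 := by
  have key : ∀ x : ι → A, (∏ t, P t (x t)) * (g (x i) * h (x j))
      = ∏ t, P t (x t) * ((if t = i then g (x t) else 1) * (if t = j then h (x t) else 1)) := by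
    intro x
    rw [Finset.prod_mul_distrib, Finset.prod_mul_distrib, Finset.prod_ite_eq' Finset.univ i,
      Finset.prod_ite_eq' Finset.univ j]
    simp
  simp_rw [key]
  rw [sum_pi_prod fun t a =>
    P t a * ((if t = i then g a else 1) * (if t = j then h a else 1))]
  apply Finset.prod_eq_zero (Finset.mem_univ i)
  simpa [hij] using hg

/-- The variance of a sum of independent centred variables. -/
lemma sum_pi_prod_mul_sq_sum {P : A → ℝ} (hP : ∑ a, P a = 1) {g : A → ℝ}
    (hg : ∑ a, P a * g a = 0) :
    ∑ x : ι → A, (∏ t, P (x t)) * (∑ i, g (x i)) ^ 2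
      = Fintype.card ι * ∑ a, P a * g a ^ 2 := by
  have h : ∀ x : ι → A, (∏ t, P (x t)) * (∑ i, g (x i)) ^ 2
      = ∑ i, ∑ j, (∏ t, P (x t)) * (g (x i) * g (x j)) := by
    intro x
    rw [sq, Finset.sum_mul_sum, Finset.mul_sum]
    exact Finset.sum_congr rfl fun i _ => Finset.mul_sum _ _ _
  simp_rw [h]
  rw [Finset.sum_comm]
  have h2 : ∀ i : ι, ∑ x : ι → A, ∑ j, (∏ t, P (x t)) * (g (x i) * g (x j))
      = ∑ a, P a * g a ^ 2 := by
    intro i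
    rw [Finset.sum_comm, Finset.sum_eq_single i]
    · rw [sum_pi_prod_mul_eval (P := fun _ => P) (fun _ => hP) i fun a => g a * g a]
      simp_rw [sq]
    · intro j _ hj
      exact sum_pi_prod_mul_eval_mul_eval (P := fun _ => P) hj.symm hg
    · simp
  simp [h2]

/-- The square of a mean is at most the mean of the square. -/
lemma sq_sum_mul_abs_le {w X : A → ℝ} (hw : ∀ a, 0 ≤ w a) (hw1 : ∑ a, w a = 1) :
    (∑ a, w a * |X a|) ^ 2 ≤ ∑ a, w a * X a ^ 2 := by
  have := Finset.sum_sq_le_sum_mul_sum_of_sq_le_mul Finset.univ (r := fun a => w a * |X a|)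
    (f := w) (g := fun a => w a * X a ^ 2) (fun a _ => hw a)
    (fun a _ => mul_nonneg (hw a) (sq_nonneg _))
    (fun a _ => by rw [mul_pow, sq_abs]; exact le_of_eq (by ring))
  rwa [hw1, one_mul] at this

/-- Expected deviation of an empirical mean of bounded weights. -/
lemma expected_deviation_truncated_le {P W : A → ℝ} (hP : ∀ a, 0 ≤ P a) (hP1 : ∑ a, P a = 1)
    (hW : ∀ a, 0 ≤ W a) {b q η : ℝ} (hq : 0 ≤ q) (hη : 0 ≤ η) (hWb : ∀ a, W a ≤ b)
    (hm : ∑ a, P a * W a ≤ q) (hι : 0 < Fintype.card ι)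
    (hb : b * q ≤ (Fintype.card ι : ℝ) * (η * q) ^ 2) :
    ∑ x : ι → A, (∏ t, P (x t)) *
      |(Fintype.card ι : ℝ)⁻¹ * ∑ i, (W (x i) - ∑ a, P a * W a)| ≤ η * q := by
  set m := ∑ a, P a * W a with hmdef
  set L := (Fintype.card ι : ℝ) with hL
  have hL0 : 0 < L := by rw [hL]; exact_mod_cast hι
  refine (le_abs_self _).trans (abs_le_of_sq_le_sq ?_ (mul_nonneg hη hq))
  -- The mean absolute deviation is bounded by the standard deviation.
  refine (sq_sum_mul_abs_le (fun x => Finset.prod_nonneg fun t _ => hP _)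
    (sum_pi_prod_eq_one fun _ => hP1)).trans ?_
  have hc : ∑ a, P a * (W a - m) = 0 := by
    simp_rw [mul_sub, Finset.sum_sub_distrib, ← Finset.sum_mul, hP1]
    rw [← hmdef]; ring
  have hv := sum_pi_prod_mul_sq_sum (ι := ι) hP1 hc
  have e1 : ∑ x : ι → A, (∏ t, P (x t)) * (L⁻¹ * ∑ i, (W (x i) - m)) ^ 2
      = L⁻¹ * ∑ a, P a * (W a - m) ^ 2 := by
    have : ∀ x : ι → A, (∏ t, P (x t)) * (L⁻¹ * ∑ i, (W (x i) - m)) ^ 2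
        = L⁻¹ ^ 2 * ((∏ t, P (x t)) * (∑ i, (W (x i) - m)) ^ 2) := fun x => by ring
    simp_rw [this]
    rw [← Finset.mul_sum, hv]
    field_simp
    ring
  have e2 : ∑ a, P a * (W a - m) ^ 2 ≤ ∑ a, P a * W a ^ 2 := by
    have : ∑ a, P a * (W a - m) ^ 2 = ∑ a, P a * W a ^ 2 - m ^ 2 := by
      have : ∀ a, P a * (W a - m) ^ 2 = P a * W a ^ 2 - 2 * m * (P a * W a) + m ^ 2 * P a :=
        fun a => by ring
      simp_rw [this, Finset.sum_add_distrib, Finset.sum_sub_distrib, ← Finset.mul_sum, hP1]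
      rw [← hmdef]; ring
    nlinarith [sq_nonneg m]
  have hb0 : ∀ a, P a * W a ^ 2 ≤ b * (P a * W a) := fun a => by
    nlinarith [mul_le_mul_of_nonneg_left (hWb a) (mul_nonneg (hP a) (hW a))]
  have e3 : ∑ a, P a * W a ^ 2 ≤ b * q := by
    -- A point of `A` is needed to know `0 ≤ b`.
    rcases isEmpty_or_nonempty A with hA | ⟨⟨a₀⟩⟩
    · simp at hP1
    · calc ∑ a, P a * W a ^ 2 ≤ b * m := by
            rw [hmdef, Finset.mul_sum]; exact Finset.sum_le_sum fun a _ => hb0 a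
        _ ≤ b * q := mul_le_mul_of_nonneg_left hm ((hW a₀).trans (hWb a₀))
  rw [e1, inv_mul_le_iff₀ hL0]
  linarith

/-- One-shot soft covering at a single output letter. -/
lemma expected_deviation_le {P W : A → ℝ} (hP : ∀ a, 0 ≤ P a) (hP1 : ∑ a, P a = 1)
    (hW : ∀ a, 0 ≤ W a) {τ η : ℝ} (hτ : 0 ≤ τ) (hη : 0 ≤ η)
    (hι : 0 < Fintype.card ι) (hτη : τ ≤ (Fintype.card ι : ℝ) * η ^ 2) :
    ∑ x : ι → A, (∏ t, P (x t)) *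
      |(Fintype.card ι : ℝ)⁻¹ * ∑ i, W (x i) - ∑ a, P a * W a|
      ≤ η * (∑ a, P a * W a)
        + 2 * ∑ a, P a * (if τ * (∑ a, P a * W a) < W a then W a else 0) := by
  set q := ∑ a, P a * W a with hq
  set L := (Fintype.card ι : ℝ) with hL
  have hL0 : 0 < L := by rw [hL]; exact_mod_cast hι
  have hq0 : 0 ≤ q := Finset.sum_nonneg fun a _ => mul_nonneg (hP a) (hW a)
  -- Truncation at `τ` times the mean: the variance bound is applied to `W₁`, while only the first
  -- moment of `W₂` is used.
  set W₁ : A → ℝ := fun a => if τ * q < W a then 0 else W a with hW₁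
  set W₂ : A → ℝ := fun a => if τ * q < W a then W a else 0 with hW₂
  have h12 : ∀ a, W a = W₁ a + W₂ a := fun a => by simp only [hW₁, hW₂]; split_ifs <;> simp
  have h1 : ∀ a, 0 ≤ W₁ a := fun a => by simp only [hW₁]; split_ifs; exacts [le_rfl, hW a]
  have h2 : ∀ a, 0 ≤ W₂ a := fun a => by simp only [hW₂]; split_ifs; exacts [hW a, le_rfl]
  set m₁ := ∑ a, P a * W₁ a
  set m₂ := ∑ a, P a * W₂ a
  have hm : q = m₁ + m₂ := by
    rw [hq, ← Finset.sum_add_distrib]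
    exact Finset.sum_congr rfl fun a _ => by rw [h12 a]; ring
  have hm₂ : 0 ≤ m₂ := Finset.sum_nonneg fun a _ => mul_nonneg (hP a) (h2 a)
  have t1 : ∑ x : ι → A, (∏ t, P (x t)) * |L⁻¹ * ∑ i, (W₁ (x i) - m₁)| ≤ η * q := by
    apply expected_deviation_truncated_le hP hP1 h1 hq0 hη (b := τ * q) _ (by linarith) hι
    · nlinarith [mul_le_mul_of_nonneg_right hτη (sq_nonneg q)]
    · intro a
      simp only [hW₁]
      split_ifs with h
      · positivity
      · exact not_lt.mp h
  have t2 : ∑ x : ι → A, (∏ t, P (x t)) * (L⁻¹ * ∑ i, W₂ (x i)) = m₂ := by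
    have : ∀ x : ι → A, (∏ t, P (x t)) * (L⁻¹ * ∑ i, W₂ (x i))
        = L⁻¹ * ∑ i, (∏ t, P (x t)) * W₂ (x i) := fun x => by
      rw [← Finset.mul_sum]; ring
    simp_rw [this]
    rw [← Finset.mul_sum, Finset.sum_comm]
    simp_rw [sum_pi_prod_mul_eval (P := fun _ => P) (fun _ => hP1)]
    simp only [Finset.sum_const, Finset.card_univ, nsmul_eq_mul]
    rw [← hL, ← mul_assoc, inv_mul_cancel₀ hL0.ne', one_mul]
  have t3 : ∑ x : ι → A, (∏ t, P (x t)) * m₂ = m₂ := by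
    rw [← Finset.sum_mul, sum_pi_prod_eq_one fun _ => hP1, one_mul]
  have hle : ∀ x : ι → A, (∏ t, P (x t)) * |L⁻¹ * ∑ i, W (x i) - q|
      ≤ (∏ t, P (x t)) * |L⁻¹ * ∑ i, (W₁ (x i) - m₁)|
        + (∏ t, P (x t)) * (L⁻¹ * ∑ i, W₂ (x i)) + (∏ t, P (x t)) * m₂ := by
    intro x
    rw [← mul_add, ← mul_add]
    refine mul_le_mul_of_nonneg_left ?_ (Finset.prod_nonneg fun t _ => hP _)
    have e : L⁻¹ * ∑ i, W (x i) - q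
        = L⁻¹ * ∑ i, (W₁ (x i) - m₁) + (L⁻¹ * ∑ i, W₂ (x i) - m₂) := by
      simp_rw [h12 (x _), Finset.sum_add_distrib, Finset.sum_sub_distrib]
      simp only [Finset.sum_const, Finset.card_univ, nsmul_eq_mul]
      rw [← hL, hm]
      field_simp
      ring
    have hp : 0 ≤ L⁻¹ * ∑ i, W₂ (x i) :=
      mul_nonneg (inv_nonneg.mpr hL0.le) (Finset.sum_nonneg fun i _ => h2 _)
    rw [e]
    refine (abs_add_le _ _).trans ?_
    rw [add_assoc]
    refine add_le_add le_rfl ?_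
    -- The empirical and the true mean of `W₂` are both nonnegative, so their difference is at most
    -- their sum; in expectation this gives the factor 2.
    rw [abs_le]
    constructor <;> linarith
  refine (Finset.sum_le_sum fun x _ => hle x).trans ?_
  rw [Finset.sum_add_distrib, Finset.sum_add_distrib, t2, t3]
  linarith

end Product

/-! ### Chernoff bound and soft covering for memoryless channels. -/

/-- An exponential moment of a variable with negative mean is below one. -/
lemma exists_sum_mul_exp_lt_one {A : Type*} [Fintype A] {J ℓ : A → ℝ} (hJ : ∑ a, J a = 1)
    (h : ∑ a, J a * ℓ a < 0) : ∃ l : ℝ, 0 < l ∧ ∑ a, J a * Real.exp (l * ℓ a) < 1 := by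
  -- The moment generating function is 1 at 0 and its slope there is the mean, which is negative.
  have hd : HasDerivAt (fun l : ℝ => ∑ a, J a * Real.exp (l * ℓ a)) (∑ a, J a * ℓ a) 0 := by
    apply HasDerivAt.fun_sum
    intro a _
    have := (((hasDerivAt_id (0 : ℝ)).mul_const (ℓ a)).exp).const_mul (J a)
    simpa using this
  have hs := (hasDerivAt_iff_tendsto_slope.mp hd).eventually (gt_mem_nhds h)
  have hs' : ∀ᶠ l : ℝ in 𝓝[>] 0, slope (fun l : ℝ => ∑ a, J a * Real.exp (l * ℓ a)) 0 l < 0 :=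
    nhdsWithin_mono 0 (fun l (hl : 0 < l) => hl.ne') hs
  obtain ⟨l, hl, hl0⟩ := (hs'.and self_mem_nhdsWithin).exists
  have hl0 : 0 < l := hl0
  refine ⟨l, hl0, ?_⟩
  rw [slope_def_field, sub_zero, div_neg_iff] at hl
  simp only [zero_mul, Real.exp_zero, mul_one, hJ] at hl
  rcases hl with ⟨_, h⟩ | ⟨h, _⟩ <;> linarith

/-- The output kernel of the channel `W` with input kernel `a`. -/
noncomputable def outKernel {Z X Y : Type*} [Fintype X] (a : Z → X → ℝ) (W : Z → X → Y → ℝ)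
    (z : Z) (y : Y) : ℝ :=
  ∑ x, a z x * W z x y

/-- The factors of a joint PMF `p z * a z x * W z x y`. -/
structure IsChain {Z X Y : Type*} [Fintype Z] [Fintype X] [Fintype Y]
    (p : Z → ℝ) (a : Z → X → ℝ) (W : Z → X → Y → ℝ) : Prop where
  p_nonneg : ∀ z, 0 ≤ p z
  a_nonneg : ∀ z x, 0 ≤ a z x
  W_nonneg : ∀ z x y, 0 ≤ W z x y
  p_sum : ∑ z, p z = 1
  a_sum : ∀ z, ∑ x, a z x = 1
  W_sum : ∀ z x, ∑ y, W z x y = 1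

namespace IsChain

variable {Z X Y : Type*} [Fintype Z] [Fintype X] [Fintype Y]
  {p : Z → ℝ} {a : Z → X → ℝ} {W : Z → X → Y → ℝ}

lemma outKernel_sum (h : IsChain p a W) (z : Z) : ∑ y, outKernel a W z y = 1 := by
  simp only [outKernel]
  rw [Finset.sum_comm]
  simp [← Finset.mul_sum, h.W_sum, h.a_sum]

lemma joint_sum (h : IsChain p a W) :
    ∑ b : Z × X × Y, p b.1 * a b.1 b.2.1 * W b.1 b.2.1 b.2.2 = 1 := by
  simp_rw [Fintype.sum_prod_type, ← Finset.mul_sum, h.W_sum, mul_one, ← Finset.mul_sum, h.a_sum,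
    mul_one, h.p_sum]

/-- Chernoff bound for the information density, for one triple of sequences. -/
lemma tail_term_le (h : IsChain p a W) {n : ℕ} {l θ : ℝ} (hl : 0 < l) (z : Fin n → Z)
    (x : Fin n → X) (y : Fin n → Y) :
    (∏ t, p (z t)) * ((∏ t, a (z t) (x t)) *
      (if Real.exp (n * θ) * ∏ t, outKernel a W (z t) (y t) < ∏ t, W (z t) (x t) (y t)
        then ∏ t, W (z t) (x t) (y t) else 0))
      ≤ ∏ t, (p (z t) * a (z t) (x t) * W (z t) (x t) (y t) *
          Real.exp (l * (Real.log (W (z t) (x t) (y t) / outKernel a W (z t) (y t)) - θ))) := by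
  have hnn : ∀ t, 0 ≤ p (z t) * a (z t) (x t) * W (z t) (x t) (y t) := fun t =>
    mul_nonneg (mul_nonneg (h.p_nonneg _) (h.a_nonneg _ _)) (h.W_nonneg _ _ _)
  have hR : 0 ≤ ∏ t, (p (z t) * a (z t) (x t) * W (z t) (x t) (y t) *
      Real.exp (l * (Real.log (W (z t) (x t) (y t) / outKernel a W (z t) (y t)) - θ))) :=
    Finset.prod_nonneg fun t _ => mul_nonneg (hnn t) (Real.exp_nonneg _)
  split_ifs with hc
  swap
  · simpa using hR
  rw [← Finset.prod_mul_distrib, ← Finset.prod_mul_distrib]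
  simp_rw [← mul_assoc]
  -- If some letter has probability zero the left side vanishes. Otherwise every ratio is positive,
  -- the logarithms add up, and `hc` makes the total exponent nonnegative.
  by_cases h0 : ∃ t, p (z t) * a (z t) (x t) * W (z t) (x t) (y t) = 0
  · obtain ⟨t, ht⟩ := h0
    rwa [Finset.prod_eq_zero (Finset.mem_univ t) ht]
  push Not at h0
  have hW : ∀ t, 0 < W (z t) (x t) (y t) := fun t =>
    (h.W_nonneg _ _ _).lt_of_ne' (right_ne_zero_of_mul (h0 t))
  have ha : ∀ t, 0 < a (z t) (x t) := fun t =>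
    (h.a_nonneg _ _).lt_of_ne' (right_ne_zero_of_mul (left_ne_zero_of_mul (h0 t)))
  have hq : ∀ t, 0 < outKernel a W (z t) (y t) := fun t =>
    (mul_pos (ha t) (hW t)).trans_le
      (Finset.single_le_sum (f := fun x => a (z t) x * W (z t) x (y t))
        (fun _ _ => mul_nonneg (h.a_nonneg _ _) (h.W_nonneg _ _ _)) (Finset.mem_univ (x t)))
  rw [Finset.prod_mul_distrib (g := fun t => Real.exp _), ← Real.exp_sum, ← Finset.mul_sum,
    Finset.sum_sub_distrib]
  refine le_mul_of_one_le_right (Finset.prod_nonneg fun t _ => hnn t) (Real.one_le_exp ?_)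
  refine mul_nonneg hl.le ?_
  rw [← Real.log_prod (fun t _ => (div_pos (hW t) (hq t)).ne'), Finset.prod_div_distrib]
  simp only [Finset.sum_const, Finset.card_univ, Fintype.card_fin, nsmul_eq_mul]
  rw [sub_nonneg, Real.le_log_iff_exp_le
    (div_pos (Finset.prod_pos fun t _ => hW t) (Finset.prod_pos fun t _ => hq t)),
    le_div_iff₀ (Finset.prod_pos fun t _ => hq t)]
  exact hc.le

/-- The bound in `tail_term_le` is a product over positions, so summing it over all sequences gives
the `n`-th power of a single-letter exponential moment. -/
lemma tail_le (h : IsChain p a W) {n : ℕ} {l θ : ℝ} (hl : 0 < l) :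
    ∑ z : Fin n → Z, (∏ t, p (z t)) * ∑ y : Fin n → Y, ∑ x : Fin n → X, (∏ t, a (z t) (x t)) *
      (if Real.exp (n * θ) * ∏ t, outKernel a W (z t) (y t) < ∏ t, W (z t) (x t) (y t)
        then ∏ t, W (z t) (x t) (y t) else 0)
      ≤ (∑ b : Z × X × Y, p b.1 * a b.1 b.2.1 * W b.1 b.2.1 b.2.2 *
          Real.exp (l * (Real.log (W b.1 b.2.1 b.2.2 / outKernel a W b.1 b.2.2) - θ))) ^ n := by
  calc _ ≤ ∑ z : Fin n → Z, ∑ y : Fin n → Y, ∑ x : Fin n → X,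
        ∏ t, (p (z t) * a (z t) (x t) * W (z t) (x t) (y t) *
          Real.exp (l * (Real.log (W (z t) (x t) (y t) / outKernel a W (z t) (y t)) - θ))) := by
        refine Finset.sum_le_sum fun z _ => ?_
        rw [Finset.mul_sum]
        refine Finset.sum_le_sum fun y _ => ?_
        rw [Finset.mul_sum]
        exact Finset.sum_le_sum fun x _ => h.tail_term_le hl z x y
    _ = (∑ z, ∑ y, ∑ x, p z * a z x * W z x y *
          Real.exp (l * (Real.log (W z x y / outKernel a W z y) - θ))) ^ n := by
        have e1 : ∀ (z : Fin n → Z) (y : Fin n → Y),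
            ∑ x : Fin n → X, ∏ t, (p (z t) * a (z t) (x t) * W (z t) (x t) (y t) *
              Real.exp (l * (Real.log (W (z t) (x t) (y t) / outKernel a W (z t) (y t)) - θ)))
            = ∏ t, ∑ x, (p (z t) * a (z t) x * W (z t) x (y t) *
              Real.exp (l * (Real.log (W (z t) x (y t) / outKernel a W (z t) (y t)) - θ))) :=
          fun z y => sum_pi_prod fun t x => (p (z t) * a (z t) x * W (z t) x (y t) *
              Real.exp (l * (Real.log (W (z t) x (y t) / outKernel a W (z t) (y t)) - θ)))
        simp_rw [e1]
        have e2 : ∀ (z : Fin n → Z),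
            ∑ y : Fin n → Y, ∏ t, ∑ x, (p (z t) * a (z t) x * W (z t) x (y t) *
              Real.exp (l * (Real.log (W (z t) x (y t) / outKernel a W (z t) (y t)) - θ)))
            = ∏ t, ∑ y, ∑ x, (p (z t) * a (z t) x * W (z t) x y *
              Real.exp (l * (Real.log (W (z t) x y / outKernel a W (z t) y) - θ))) :=
          fun z => sum_pi_prod fun t y => ∑ x, (p (z t) * a (z t) x * W (z t) x y *
              Real.exp (l * (Real.log (W (z t) x y / outKernel a W (z t) y) - θ)))
        simp_rw [e2]
        rw [sum_pi_prod fun (_ : Fin n) z => ∑ y, ∑ x, (p z * a z x * W z x y *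
              Real.exp (l * (Real.log (W z x y / outKernel a W z y) - θ)))]
        simp
    _ = _ := by
        congr 1
        simp_rw [Fintype.sum_prod_type]
        exact Finset.sum_congr rfl fun z _ => Finset.sum_comm

/-- Soft covering: if the rate exceeds the conditional mutual information, the output law induced
by a random codebook is exponentially close to the memoryless output law. -/
theorem exists_covering_rate (h : IsChain p a W) {R : ℝ}
    (hI : ∑ z, ∑ x, ∑ y, p z * a z x * W z x y *
      Real.logb 2 (W z x y / outKernel a W z y) < R) :
    ∃ ρ : ℝ, 0 < ρ ∧ ρ < 1 ∧ ∀ (n : ℕ) (ι : Type) [Fintype ι] [DecidableEq ι],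
      (2 : ℝ) ^ ((n : ℝ) * R) ≤ 4 * Fintype.card ι →
      ∑ z : Fin n → Z, (∏ t, p (z t)) *
        ∑ B : ι → Fin n → X, (∏ i, ∏ t, a (z t) (B i t)) *
          ∑ y : Fin n → Y, |(Fintype.card ι : ℝ)⁻¹ * ∑ i, ∏ t, W (z t) (B i t) (y t)
            - ∏ t, outKernel a W (z t) (y t)| ≤ 4 * ρ ^ n := by
  set I := ∑ z, ∑ x, ∑ y, p z * a z x * W z x y *
      Real.logb 2 (W z x y / outKernel a W z y) with hIdef
  have hlog2 : 0 < Real.log 2 := Real.log_pos one_lt_two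
  -- The truncation exponent lies midway between information and rate, in nats: above `I` for the
  -- Chernoff bound, below `R` for the variance bound.
  set θ := (I + R) / 2 * Real.log 2 with hθ
  have hθR : θ < R * Real.log 2 := mul_lt_mul_of_pos_right (by linarith) hlog2
  have hIθ : I * Real.log 2 < θ := mul_lt_mul_of_pos_right (by linarith) hlog2
  obtain ⟨l, hl, hl1⟩ := exists_sum_mul_exp_lt_one h.joint_sum
    (ℓ := fun b => Real.log (W b.1 b.2.1 b.2.2 / outKernel a W b.1 b.2.2) - θ) (by
      simp_rw [mul_sub, Finset.sum_sub_distrib, ← Finset.sum_mul]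
      rw [h.joint_sum, one_mul, sub_neg]
      convert hIθ using 1
      rw [hIdef]
      simp_rw [Fintype.sum_prod_type, Finset.sum_mul]
      refine Finset.sum_congr rfl fun z _ => Finset.sum_congr rfl fun x _ =>
        Finset.sum_congr rfl fun y _ => ?_
      rw [Real.logb, mul_assoc _ (_ / _), div_mul_cancel₀ _ hlog2.ne'])
  set f := ∑ b : Z × X × Y, p b.1 * a b.1 b.2.1 * W b.1 b.2.1 b.2.2 *
          Real.exp (l * (Real.log (W b.1 b.2.1 b.2.2 / outKernel a W b.1 b.2.2) - θ)) with hf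
  have hf0 : 0 ≤ f := Finset.sum_nonneg fun b _ => mul_nonneg (mul_nonneg (mul_nonneg
    (h.p_nonneg _) (h.a_nonneg _ _)) (h.W_nonneg _ _ _)) (Real.exp_nonneg _)
  -- Chosen so that `η = 2 * r ^ n` satisfies `exp (n * θ) ≤ card ι * η ^ 2`; the 2 compensates the
  -- 4 lost in the cardinality hypothesis.
  set r := Real.exp (-(R * Real.log 2 - θ) / 2) with hr
  refine ⟨max r f, lt_max_of_lt_left (Real.exp_pos _), max_lt ?_ hl1, ?_⟩
  · rw [hr, Real.exp_lt_one_iff]; linarith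
  intro n ι _ _ hcard
  have hpow : (2 : ℝ) ^ ((n : ℝ) * R) = Real.exp (n * (R * Real.log 2)) := by
    rw [Real.rpow_def_of_pos two_pos]; congr 1; ring
  have hι : 0 < Fintype.card ι := by
    have h0 : (0 : ℝ) < 4 * Fintype.card ι := (Real.rpow_pos_of_pos two_pos _).trans_le hcard
    exact_mod_cast (pos_of_mul_pos_right h0 (by norm_num) : (0 : ℝ) < Fintype.card ι)
  have hη : 0 ≤ 2 * r ^ n := by positivity
  have hτη : Real.exp (n * θ) ≤ (Fintype.card ι : ℝ) * (2 * r ^ n) ^ 2 := by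
    have e : (2 * r ^ n) ^ 2 = 4 * Real.exp (-(n * (R * Real.log 2 - θ))) := by
      rw [hr, ← Real.exp_nat_mul, mul_pow, ← Real.exp_nat_mul]
      norm_num
      ring
    have e' : (Fintype.card ι : ℝ) * (2 * r ^ n) ^ 2
        = 4 * Fintype.card ι * Real.exp (-(n * (R * Real.log 2 - θ))) := by rw [e]; ring
    rw [e']
    refine le_trans ?_ (mul_le_mul_of_nonneg_right hcard (Real.exp_nonneg _))
    rw [hpow, ← Real.exp_add]
    exact le_of_eq (by congr 1; ring)
  have hz : ∀ z : Fin n → Z, ∑ B : ι → Fin n → X, (∏ i, ∏ t, a (z t) (B i t)) *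
          ∑ y : Fin n → Y, |(Fintype.card ι : ℝ)⁻¹ * ∑ i, ∏ t, W (z t) (B i t) (y t)
            - ∏ t, outKernel a W (z t) (y t)|
      ≤ 2 * r ^ n + 2 * ∑ y : Fin n → Y, ∑ x : Fin n → X, (∏ t, a (z t) (x t)) *
      (if Real.exp (n * θ) * ∏ t, outKernel a W (z t) (y t) < ∏ t, W (z t) (x t) (y t)
        then ∏ t, W (z t) (x t) (y t) else 0) := by
    intro z
    simp_rw [Finset.mul_sum (s := (Finset.univ : Finset (Fin n → Y)))]
    rw [Finset.sum_comm]
    have hq : ∀ y : Fin n → Y, ∏ t, outKernel a W (z t) (y t)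
        = ∑ x : Fin n → X, (∏ t, a (z t) (x t)) * ∏ t, W (z t) (x t) (y t) := by
      intro y
      simp_rw [← Finset.prod_mul_distrib]
      exact (sum_pi_prod fun t x => a (z t) x * W (z t) x (y t)).symm
    have hsum : ∑ y : Fin n → Y, ∏ t, outKernel a W (z t) (y t) = 1 :=
      sum_pi_prod_eq_one (P := fun t => outKernel a W (z t)) fun t => h.outKernel_sum (z t)
    have hy : ∀ y : Fin n → Y, ∑ B : ι → Fin n → X, (∏ i, ∏ t, a (z t) (B i t)) *
          |(Fintype.card ι : ℝ)⁻¹ * ∑ i, ∏ t, W (z t) (B i t) (y t)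
            - ∏ t, outKernel a W (z t) (y t)|
        ≤ 2 * r ^ n * (∏ t, outKernel a W (z t) (y t)) +
          2 * ∑ x : Fin n → X, (∏ t, a (z t) (x t)) *
      (if Real.exp (n * θ) * ∏ t, outKernel a W (z t) (y t) < ∏ t, W (z t) (x t) (y t)
        then ∏ t, W (z t) (x t) (y t) else 0) := by
      intro y
      have := expected_deviation_le (ι := ι) (P := fun x : Fin n → X => ∏ t, a (z t) (x t))
        (W := fun x => ∏ t, W (z t) (x t) (y t))
        (fun x => Finset.prod_nonneg fun t _ => h.a_nonneg _ _)
        (sum_pi_prod_eq_one (P := fun t => a (z t)) fun t => h.a_sum (z t))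
        (fun x => Finset.prod_nonneg fun t _ => h.W_nonneg _ _ _) (Real.exp_nonneg _) hη hι hτη
      rw [← hq y] at this
      exact this
    refine (Finset.sum_le_sum fun y _ => hy y).trans (le_of_eq ?_)
    rw [Finset.sum_add_distrib, ← Finset.mul_sum, hsum, mul_one]
  have hp1 : ∑ z : Fin n → Z, ∏ t, p (z t) = 1 :=
    sum_pi_prod_eq_one (P := fun _ => p) fun _ => h.p_sum
  refine (Finset.sum_le_sum fun z _ => mul_le_mul_of_nonneg_left (hz z)
    (Finset.prod_nonneg fun t _ => h.p_nonneg _)).trans ?_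
  simp_rw [mul_add, mul_left_comm _ (2 : ℝ)]
  rw [Finset.sum_add_distrib, ← Finset.mul_sum, ← Finset.mul_sum, ← Finset.sum_mul, hp1, one_mul]
  have ht := h.tail_le (n := n) (θ := θ) hl
  have m1 : r ^ n ≤ (max r f) ^ n := pow_le_pow_left₀ (Real.exp_nonneg _) (le_max_left _ _) n
  have m2 : f ^ n ≤ (max r f) ^ n := pow_le_pow_left₀ hf0 (le_max_right _ _) n
  linarith

end IsChain

/-! ### Conditional PMFs and mutual information in terms of channels. -/

section Conditional

variable {X Y : Type*} [Fintype Y] {J : X → Y → ℝ}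

lemma condPMF_nonneg (hJ : ∀ x y, 0 ≤ J x y) (x : X) (y : Y) : 0 ≤ condPMF J x y := by
  unfold condPMF
  split_ifs
  · positivity
  · exact div_nonneg (hJ _ _) (Finset.sum_nonneg fun _ _ => hJ _ _)

lemma condPMF_sum [Nonempty Y] (J : X → Y → ℝ) (x : X) : ∑ y, condPMF J x y = 1 := by
  unfold condPMF
  split_ifs with h
  · simp
  · rw [← Finset.sum_div, div_self h]

/-- A nonnegative row of total mass zero vanishes identically, so the uniform convention plays no
role here. -/
lemma sum_mul_condPMF (hJ : ∀ x y, 0 ≤ J x y) (x : X) (y : Y) :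
    (∑ y', J x y') * condPMF J x y = J x y := by
  unfold condPMF
  split_ifs with h
  · rw [h, zero_mul, (Finset.sum_eq_zero_iff_of_nonneg fun _ _ => hJ _ _).mp h y
      (Finset.mem_univ y)]
  · rw [mul_div_cancel₀ _ h]

end Conditional

lemma IsChain.condMutualInfo_eq {Z X Y : Type*} [Fintype Z] [Fintype X] [Fintype Y]
    {p : Z → ℝ} {a : Z → X → ℝ} {W : Z → X → Y → ℝ} (h : IsChain p a W) {J : Z → X → Y → ℝ}
    (hJ : ∀ z x y, J z x y = p z * a z x * W z x y) :
    condMutualInfo J = ∑ z, ∑ x, ∑ y, p z * a z x * W z x y *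
      Real.logb 2 (W z x y / outKernel a W z y) := by
  have hx : ∀ z x, ∑ y, J z x y = p z * a z x := fun z x => by
    simp_rw [hJ, ← Finset.mul_sum, h.W_sum, mul_one]
  have hz : ∀ z, ∑ x, ∑ y, J z x y = p z := fun z => by
    simp_rw [hx, ← Finset.mul_sum, h.a_sum, mul_one]
  have hy : ∀ z y, ∑ x, J z x y = p z * outKernel a W z y := fun z y => by
    simp_rw [hJ, mul_assoc, ← Finset.mul_sum, outKernel]
  unfold condMutualInfo
  refine Finset.sum_congr rfl fun z _ => Finset.sum_congr rfl fun x _ =>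
    Finset.sum_congr rfl fun y _ => ?_
  rw [hx, hz, hy, hJ]
  -- Weight zero kills both terms; otherwise `p z * a z x * p z` cancels in the ratio.
  by_cases h0 : p z * a z x = 0
  · rw [h0]; simp
  · have hp := left_ne_zero_of_mul h0
    have ha := right_ne_zero_of_mul h0
    congr 2
    rw [show p z * a z x * W z x y * p z = p z * a z x * p z * W z x y by ring,
      show p z * a z x * (p z * outKernel a W z y) = p z * a z x * p z * outKernel a W z y by ring,
      mul_div_mul_left _ _ (mul_ne_zero h0 hp)]

/-! ### Single-letter factorizations of `Q`. -/

section Single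

variable {S₀ S U V : Type*} [Fintype S₀] [Fintype S] [Fintype U] [Fintype V]

/-- The marginal `Q_{S₀}`. -/
def margS₀ (Q : S₀ × S × U × V → ℝ) (s₀ : S₀) : ℝ := ∑ u, ∑ s, ∑ v, Q (s₀, s, u, v)

/-- `Q_{S,V|U,S₀}`. -/
noncomputable def kerSV (Q : S₀ × S × U × V → ℝ) (s₀ : S₀) (u : U) (y : S × V) : ℝ :=
  kerS Q (u, s₀) y.1 * kerV Q (u, s₀, y.1) y.2

variable {Q : S₀ × S × U × V → ℝ}

lemma nonempty_of_mem_stdSimplex (hQ : Q ∈ stdSimplex ℝ (S₀ × S × U × V)) :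
    Nonempty (S₀ × S × U × V) := by
  by_contra h
  rw [not_nonempty_iff] at h
  simpa using hQ.2

lemma margS₀_nonneg (hQ : ∀ x, 0 ≤ Q x) (s₀ : S₀) : 0 ≤ margS₀ Q s₀ :=
  Finset.sum_nonneg fun _ _ => Finset.sum_nonneg fun _ _ => Finset.sum_nonneg fun _ _ => hQ _

lemma kerU_nonneg (hQ : ∀ x, 0 ≤ Q x) (s₀ : S₀) (u : U) : 0 ≤ kerU Q s₀ u :=
  condPMF_nonneg (fun _ _ => Finset.sum_nonneg fun _ _ => Finset.sum_nonneg fun _ _ => hQ _) _ _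

lemma kerS_nonneg (hQ : ∀ x, 0 ≤ Q x) (x : U × S₀) (s : S) : 0 ≤ kerS Q x s :=
  condPMF_nonneg (fun _ _ => Finset.sum_nonneg fun _ _ => hQ _) _ _

lemma kerV_nonneg (hQ : ∀ x, 0 ≤ Q x) (x : U × S₀ × S) (v : V) : 0 ≤ kerV Q x v :=
  condPMF_nonneg (fun _ _ => hQ _) _ _

lemma targetV_nonneg (hQ : ∀ x, 0 ≤ Q x) (x : S₀ × S) (v : V) : 0 ≤ targetV Q x v :=
  condPMF_nonneg (fun _ _ => Finset.sum_nonneg fun _ _ => hQ _) _ _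

lemma margS₀_mul_kerU (hQ : ∀ x, 0 ≤ Q x) (s₀ : S₀) (u : U) :
    margS₀ Q s₀ * kerU Q s₀ u = ∑ s, ∑ v, Q (s₀, s, u, v) :=
  sum_mul_condPMF (J := fun s₀ u => ∑ s, ∑ v, Q (s₀, s, u, v))
    (fun _ _ => Finset.sum_nonneg fun _ _ => Finset.sum_nonneg fun _ _ => hQ _) s₀ u

lemma margS₀_mul_kerU_mul_kerS (hQ : ∀ x, 0 ≤ Q x) (s₀ : S₀) (u : U) (s : S) :
    margS₀ Q s₀ * kerU Q s₀ u * kerS Q (u, s₀) s = ∑ v, Q (s₀, s, u, v) := by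
  rw [margS₀_mul_kerU hQ]
  exact sum_mul_condPMF (J := fun (x : U × S₀) s => ∑ v, Q (x.2, s, x.1, v))
    (fun _ _ => Finset.sum_nonneg fun _ _ => hQ _) (u, s₀) s

lemma margS₀_mul_kerU_mul_kerSV (hQ : ∀ x, 0 ≤ Q x) (s₀ : S₀) (u : U) (y : S × V) :
    margS₀ Q s₀ * kerU Q s₀ u * kerSV Q s₀ u y = Q (s₀, y.1, u, y.2) := by
  rw [kerSV, ← mul_assoc, margS₀_mul_kerU_mul_kerS hQ]
  exact sum_mul_condPMF (J := fun (x : U × S₀ × S) v => Q (x.2.1, x.2.2, x.1, v))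
    (fun _ _ => hQ _) (u, s₀, y.1) y.2

lemma margS₀S_mul_targetV (hQ : ∀ x, 0 ≤ Q x) (x : S₀ × S) (v : V) :
    margS₀S Q x * targetV Q x v = margS₀SV Q (x.1, x.2, v) := by
  rw [margS₀S, Finset.sum_comm]
  exact sum_mul_condPMF (J := fun (x : S₀ × S) v => ∑ u, Q (x.1, x.2, u, v))
    (fun _ _ => Finset.sum_nonneg fun _ _ => hQ _) x v

lemma isChain_kerS (hQ : Q ∈ stdSimplex ℝ (S₀ × S × U × V)) :
    IsChain (margS₀ Q) (kerU Q) (fun s₀ u => kerS Q (u, s₀)) := by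
  obtain ⟨⟨s₀, s, u, v⟩⟩ := nonempty_of_mem_stdSimplex hQ
  have : Nonempty S := ⟨s⟩
  have : Nonempty U := ⟨u⟩
  refine ⟨margS₀_nonneg hQ.1, kerU_nonneg hQ.1, fun _ _ => kerS_nonneg hQ.1 _, ?_,
    fun _ => condPMF_sum _ _, fun _ _ => condPMF_sum _ _⟩
  rw [← hQ.2]
  simp_rw [Fintype.sum_prod_type, margS₀]
  exact Finset.sum_congr rfl fun _ _ => Finset.sum_comm

lemma kerV_sum (hQ : Q ∈ stdSimplex ℝ (S₀ × S × U × V)) (x : U × S₀ × S) :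
    ∑ v, kerV Q x v = 1 := by
  obtain ⟨⟨s₀, s, u, v⟩⟩ := nonempty_of_mem_stdSimplex hQ
  have : Nonempty V := ⟨v⟩
  exact condPMF_sum _ _

lemma isChain_kerSV (hQ : Q ∈ stdSimplex ℝ (S₀ × S × U × V)) :
    IsChain (margS₀ Q) (kerU Q) (kerSV Q) := by
  have h := isChain_kerS hQ
  refine ⟨h.p_nonneg, h.a_nonneg,
    fun _ _ _ => mul_nonneg (kerS_nonneg hQ.1 _ _) (kerV_nonneg hQ.1 _ _), h.p_sum, h.a_sum,
    fun s₀ u => ?_⟩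
  simp_rw [kerSV, Fintype.sum_prod_type, ← Finset.mul_sum, kerV_sum hQ, mul_one]
  exact h.W_sum s₀ u

lemma margS₀S_eq (hQ : ∀ x, 0 ≤ Q x) (s₀ : S₀) (s : S) :
    margS₀S Q (s₀, s)
      = margS₀ Q s₀ * outKernel (kerU Q) (fun s₀ u => kerS Q (u, s₀)) s₀ s := by
  simp_rw [outKernel, Finset.mul_sum, ← mul_assoc, margS₀_mul_kerU_mul_kerS hQ]
  rfl

lemma margS₀SV_eq (hQ : ∀ x, 0 ≤ Q x) (s₀ : S₀) (s : S) (v : V) :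
    margS₀SV Q (s₀, s, v) = margS₀ Q s₀ * outKernel (kerU Q) (kerSV Q) s₀ (s, v) := by
  simp_rw [outKernel, Finset.mul_sum, ← mul_assoc, margS₀_mul_kerU_mul_kerSV hQ]
  rfl

lemma infoUS_eq (hQ : Q ∈ stdSimplex ℝ (S₀ × S × U × V)) :
    infoUS Q = ∑ s₀, ∑ u, ∑ s, margS₀ Q s₀ * kerU Q s₀ u * kerS Q (u, s₀) s *
      Real.logb 2 (kerS Q (u, s₀) s / outKernel (kerU Q) (fun s₀ u => kerS Q (u, s₀)) s₀ s) :=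
  (isChain_kerS hQ).condMutualInfo_eq fun s₀ u s => (margS₀_mul_kerU_mul_kerS hQ.1 s₀ u s).symm

lemma infoUSV_eq (hQ : Q ∈ stdSimplex ℝ (S₀ × S × U × V)) :
    infoUSV Q = ∑ s₀, ∑ u, ∑ y, margS₀ Q s₀ * kerU Q s₀ u * kerSV Q s₀ u y *
      Real.logb 2 (kerSV Q s₀ u y / outKernel (kerU Q) (kerSV Q) s₀ y) :=
  (isChain_kerSV hQ).condMutualInfo_eq fun s₀ u y => (margS₀_mul_kerU_mul_kerSV hQ.1 s₀ u y).symm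

/-- A letter that the channels can produce lies in the support of the target. -/
lemma targetV_ne_zero (hQ : ∀ x, 0 ≤ Q x) {s₀ : S₀} {s : S} {u : U} {v : V}
    (h : margS₀S Q (s₀, s) ≠ 0) (hu : kerU Q s₀ u ≠ 0) (hs : kerS Q (u, s₀) s ≠ 0)
    (hv : kerV Q (u, s₀, s) v ≠ 0) : targetV Q (s₀, s) v ≠ 0 := by
  have hp : margS₀ Q s₀ ≠ 0 := by
    rw [margS₀S_eq hQ] at h
    exact left_ne_zero_of_mul h
  have hq : 0 < Q (s₀, s, u, v) := by
    refine (hQ _).lt_of_ne' ?_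
    rw [← margS₀_mul_kerU_mul_kerSV hQ s₀ u (s, v), kerSV]
    exact mul_ne_zero (mul_ne_zero hp hu) (mul_ne_zero hs hv)
  have hm : 0 < margS₀SV Q (s₀, s, v) :=
    hq.trans_le (Finset.single_le_sum (f := fun u => Q (s₀, s, u, v)) (fun _ _ => hQ _)
      (Finset.mem_univ u))
  have h' := margS₀S_mul_targetV hQ (s₀, s) v
  intro h0
  rw [h0, mul_zero] at h'
  exact hm.ne h'

end Single

/-! ### The output law and its comparison with the target. -/

section Output

variable {S₀ S U V : Type*} [Fintype S₀] [Fintype S] [Fintype U] [Fintype V] {n M K : ℕ}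
  {Q : S₀ × S × U × V → ℝ}

open Classical in
/-- The law of the output given the message, `s₀` and `s`. -/
noncomputable def messageLaw (Q : S₀ × S × U × V → ℝ) (B : Codebook S₀ U n M K)
    (F : Fin M → (Fin n → S₀) → (Fin n → S) → (Fin n → V) → ℝ) (w : Fin M)
    (s₀ : Fin n → S₀) (s : Fin n → S) (v : Fin n → V) : ℝ :=
  (∑ i, likEncoder Q B s₀ s w i * prodKernel (kerV Q) (fun t => (B s₀ w i t, s₀ t, s t)) v)
    + if ∑ i, likelihood Q B s₀ s w i = 0 then F w s₀ s v else 0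

lemma outputLaw_eq (B : Codebook S₀ U n M K)
    (F : Fin M → (Fin n → S₀) → (Fin n → S) → (Fin n → V) → ℝ)
    (s₀ : Fin n → S₀) (s : Fin n → S) (v : Fin n → V) :
    outputLaw Q B F s₀ s v = ∑ w, (M : ℝ)⁻¹ * messageLaw Q B F w s₀ s v := rfl

lemma likelihood_nonneg (hQ : ∀ x, 0 ≤ Q x) (B : Codebook S₀ U n M K) (s₀ : Fin n → S₀)
    (s : Fin n → S) (w : Fin M) (i : Fin K) : 0 ≤ likelihood Q B s₀ s w i := by
  rw [likelihood, prodKernel]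
  exact Finset.prod_nonneg fun _ _ => kerS_nonneg hQ _ _

lemma likEncoder_nonneg (hQ : ∀ x, 0 ≤ Q x) (B : Codebook S₀ U n M K) (s₀ : Fin n → S₀)
    (s : Fin n → S) (w : Fin M) (i : Fin K) : 0 ≤ likEncoder Q B s₀ s w i :=
  div_nonneg (likelihood_nonneg hQ _ _ _ _ _)
    (Finset.sum_nonneg fun _ _ => likelihood_nonneg hQ _ _ _ _ _)

lemma prodKernel_kerV_nonneg (hQ : ∀ x, 0 ≤ Q x) (x : Fin n → U × S₀ × S) (v : Fin n → V) :
    0 ≤ prodKernel (kerV Q) x v :=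
  Finset.prod_nonneg fun _ _ => kerV_nonneg hQ _ _

lemma prodKernel_kerV_sum (hQ : Q ∈ stdSimplex ℝ (S₀ × S × U × V)) (x : Fin n → U × S₀ × S) :
    ∑ v : Fin n → V, prodKernel (kerV Q) x v = 1 :=
  sum_pi_prod_eq_one (P := fun t => kerV Q (x t)) fun t => kerV_sum hQ (x t)

variable {B : Codebook S₀ U n M K} {F : Fin M → (Fin n → S₀) → (Fin n → S) → (Fin n → V) → ℝ}

lemma messageLaw_nonneg (hQ : ∀ x, 0 ≤ Q x) (hF : ∀ w s₀ s v, 0 ≤ F w s₀ s v) (w : Fin M)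
    (s₀ : Fin n → S₀) (s : Fin n → S) (v : Fin n → V) : 0 ≤ messageLaw Q B F w s₀ s v := by
  refine add_nonneg (Finset.sum_nonneg fun i _ => mul_nonneg (likEncoder_nonneg hQ _ _ _ _ _)
    (prodKernel_kerV_nonneg hQ _ _)) ?_
  split_ifs
  exacts [hF _ _ _ _, le_rfl]

/-- The encoder has mass one, or mass zero exactly where `F` takes over. -/
lemma messageLaw_sum_le (hQ : Q ∈ stdSimplex ℝ (S₀ × S × U × V))
    (hF : ∀ w s₀ s, ∑ v, F w s₀ s v ≤ 1) (w : Fin M)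
    (s₀ : Fin n → S₀) (s : Fin n → S) : ∑ v, messageLaw Q B F w s₀ s v ≤ 1 := by
  simp only [messageLaw]
  rw [Finset.sum_add_distrib, Finset.sum_comm]
  simp_rw [← Finset.mul_sum, prodKernel_kerV_sum hQ, mul_one]
  split_ifs with h
  · simp only [likEncoder, h, div_zero, Finset.sum_const_zero, zero_add]
    exact hF w s₀ s
  · simp only [likEncoder, ← Finset.sum_div, div_self h, Finset.sum_const_zero, add_zero, le_refl]

/-- The likelihood encoder is the posterior of the index: Bayes' rule. -/
lemma sum_likelihood_mul_messageLaw (hQ : ∀ x, 0 ≤ Q x) (w : Fin M)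
    (s₀ : Fin n → S₀) (s : Fin n → S) (v : Fin n → V) :
    (∑ i, likelihood Q B s₀ s w i) * messageLaw Q B F w s₀ s v
      = ∑ i, likelihood Q B s₀ s w i *
          prodKernel (kerV Q) (fun t => (B s₀ w i t, s₀ t, s t)) v := by
  by_cases h : ∑ i, likelihood Q B s₀ s w i = 0
  · have h' := (Finset.sum_eq_zero_iff_of_nonneg fun i _ => likelihood_nonneg hQ B s₀ s w i).mp h
    rw [h, zero_mul]
    exact (Finset.sum_eq_zero fun i hi => by rw [h' i hi, zero_mul]).symm
  · rw [messageLaw, if_neg h, add_zero, Finset.mul_sum]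
    refine Finset.sum_congr rfl fun i _ => ?_
    rw [likEncoder, ← mul_assoc, mul_div_cancel₀ _ h]

lemma outputLaw_nonneg (hQ : ∀ x, 0 ≤ Q x) (hF : ∀ w s₀ s v, 0 ≤ F w s₀ s v)
    (s₀ : Fin n → S₀) (s : Fin n → S) (v : Fin n → V) : 0 ≤ outputLaw Q B F s₀ s v :=
  Finset.sum_nonneg fun w _ => mul_nonneg (by positivity) (messageLaw_nonneg hQ hF w s₀ s v)

lemma outputLaw_le_one (hQ : Q ∈ stdSimplex ℝ (S₀ × S × U × V))
    (hF : ∀ w s₀ s v, 0 ≤ F w s₀ s v) (hF1 : ∀ w s₀ s, ∑ v, F w s₀ s v ≤ 1)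
    (s₀ : Fin n → S₀) (s : Fin n → S) (v : Fin n → V) : outputLaw Q B F s₀ s v ≤ 1 := by
  have h : ∀ w, messageLaw Q B F w s₀ s v ≤ 1 := fun w =>
    (Finset.single_le_sum (fun v _ => messageLaw_nonneg hQ.1 hF w s₀ s v)
      (Finset.mem_univ v)).trans (messageLaw_sum_le hQ hF1 w s₀ s)
  rw [outputLaw_eq, ← Finset.mul_sum]
  refine inv_mul_le_one_of_le₀ ?_ (by positivity)
  refine (Finset.sum_le_sum fun w _ => h w).trans ?_
  simp

/-- The output law stays in the support of the target. -/
lemma outputLaw_eq_zero [DecidableEq S₀] (hQ : ∀ x, 0 ≤ Q x) (hB : 0 < codebookLaw Q B)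
    {s₀ : Fin n → S₀} {s : Fin n → S} {v : Fin n → V}
    (hs : 0 < prodPMF (margS₀S Q) (fun t => (s₀ t, s t)))
    (hv : prodKernel (targetV Q) (fun t => (s₀ t, s t)) v = 0)
    (hF : ∀ w, F w s₀ s v = 0) : outputLaw Q B F s₀ s v = 0 := by
  rw [outputLaw_eq]
  refine Finset.sum_eq_zero fun w _ => ?_
  rw [messageLaw, hF, ite_self, add_zero]
  convert mul_zero _
  refine Finset.sum_eq_zero fun i _ => ?_
  obtain ⟨t, -, ht⟩ := Finset.prod_eq_zero_iff.mp hv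
  -- A nonzero term would give position `t` a codeword letter and an output letter of positive joint
  -- probability, contradicting `ht`.
  by_contra hne
  have hl : likelihood Q B s₀ s w i ≠ 0 := (div_ne_zero_iff.mp (left_ne_zero_of_mul hne)).1
  have hk := right_ne_zero_of_mul hne
  rw [likelihood, prodKernel] at hl
  refine targetV_ne_zero hQ (u := B s₀ w i t)
    (Finset.prod_ne_zero_iff.mp hs.ne' t (Finset.mem_univ t)) ?_
    (Finset.prod_ne_zero_iff.mp hl t (Finset.mem_univ t))
    (Finset.prod_ne_zero_iff.mp hk t (Finset.mem_univ t)) ht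
  have h1 := Finset.prod_ne_zero_iff.mp hB.ne' s₀ (Finset.mem_univ _)
  have h2 := Finset.prod_ne_zero_iff.mp h1 w (Finset.mem_univ _)
  have h3 := Finset.prod_ne_zero_iff.mp h2 i (Finset.mem_univ _)
  exact Finset.prod_ne_zero_iff.mp h3 t (Finset.mem_univ t)

/-- Distance of the law of `s` induced by the codewords `b` from the target. -/
noncomputable def binDeviation (Q : S₀ × S × U × V → ℝ) (s₀ : Fin n → S₀)
    (b : Fin K → Fin n → U) : ℝ :=
  ∑ s : Fin n → S, |(K : ℝ)⁻¹ * ∑ i, ∏ t, kerS Q (b i t, s₀ t) (s t)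
    - ∏ t, outKernel (kerU Q) (fun s₀ u => kerS Q (u, s₀)) (s₀ t) (s t)|

/-- Distance of the law of `(s, v)` induced by the codewords `r` from the target. -/
noncomputable def rowDeviation (Q : S₀ × S × U × V → ℝ) (s₀ : Fin n → S₀)
    (r : Fin M → Fin K → Fin n → U) : ℝ :=
  ∑ s : Fin n → S, ∑ v : Fin n → V,
    |(M : ℝ)⁻¹ * ∑ w, (K : ℝ)⁻¹ * ∑ i, ∏ t, kerSV Q (s₀ t) (r w i t) (s t, v t)
      - ∏ t, outKernel (kerU Q) (kerSV Q) (s₀ t) (s t, v t)|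

/-- The total variation is controlled by two soft-covering deviations. -/
lemma two_mul_jointTV_le (hQ : Q ∈ stdSimplex ℝ (S₀ × S × U × V))
    (hF : ∀ w s₀ s v, 0 ≤ F w s₀ s v) (hF1 : ∀ w s₀ s, ∑ v, F w s₀ s v ≤ 1) :
    2 * jointTV Q (outputLaw Q B F) ≤
      ∑ s₀ : Fin n → S₀, (∏ t, margS₀ Q (s₀ t)) *
        ((M : ℝ)⁻¹ * ∑ w, binDeviation Q s₀ (B s₀ w) + rowDeviation Q s₀ (B s₀)) := by
  unfold jointTV tvDist
  rw [← mul_assoc, show (2 : ℝ) * (1 / 2) = 1 by norm_num, one_mul]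
  simp_rw [Fintype.sum_prod_type]
  refine Finset.sum_le_sum fun s₀ _ => ?_
  set p := ∏ t, margS₀ Q (s₀ t) with hp
  have hp0 : 0 ≤ p := Finset.prod_nonneg fun t _ => margS₀_nonneg hQ.1 _
  set q₁ : (Fin n → S) → ℝ := fun s =>
    ∏ t, outKernel (kerU Q) (fun s₀ u => kerS Q (u, s₀)) (s₀ t) (s t) with hq₁
  set q₂ : (Fin n → S) → (Fin n → V) → ℝ := fun s v =>
    ∏ t, outKernel (kerU Q) (kerSV Q) (s₀ t) (s t, v t) with hq₂
  set Γ : Fin M → (Fin n → S) → ℝ := fun w s => (K : ℝ)⁻¹ * ∑ i, likelihood Q B s₀ s w i with hΓ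
  set m : Fin M → (Fin n → S) → (Fin n → V) → ℝ := fun w s v => messageLaw Q B F w s₀ s v with hm
  have hm0 : ∀ w s v, 0 ≤ m w s v := fun w s v => messageLaw_nonneg hQ.1 hF w s₀ s v
  have hm1 : ∀ w s, ∑ v, m w s v ≤ 1 := fun w s => messageLaw_sum_le hQ hF1 w s₀ s
  have e1 : ∀ s, prodPMF (margS₀S Q) (fun t => (s₀ t, s t)) = p * q₁ s := fun s => by
    simp_rw [prodPMF, margS₀S_eq hQ.1, Finset.prod_mul_distrib, hp, hq₁]
  have e2 : ∀ s v, prodPMF (margS₀SV Q) (fun t => (s₀ t, s t, v t)) = p * q₂ s v := fun s v => by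
    simp_rw [prodPMF, margS₀SV_eq hQ.1, Finset.prod_mul_distrib, hp, hq₂]
  have e3 : ∀ w s v, Γ w s * m w s v
      = (K : ℝ)⁻¹ * ∑ i, ∏ t, kerSV Q (s₀ t) (B s₀ w i t) (s t, v t) := fun w s v => by
    simp only [hΓ, hm]
    rw [mul_assoc, sum_likelihood_mul_messageLaw hQ.1]
    simp only [kerSV, Finset.prod_mul_distrib]
    rfl
  have e4 : ∀ w, binDeviation Q s₀ (B s₀ w) = ∑ s, |Γ w s - q₁ s| := fun w => rfl
  have e5 : rowDeviation Q s₀ (B s₀)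
      = ∑ s, ∑ v, |(M : ℝ)⁻¹ * ∑ w, Γ w s * m w s v - q₂ s v| := by
    simp_rw [e3]; rfl
  have hpt : ∀ s v, |p * q₁ s * outputLaw Q B F s₀ s v - p * q₂ s v|
      ≤ p * ((M : ℝ)⁻¹ * ∑ w, |Γ w s - q₁ s| * m w s v
        + |(M : ℝ)⁻¹ * ∑ w, Γ w s * m w s v - q₂ s v|) := by
    intro s v
    rw [mul_assoc, ← mul_sub, abs_mul, abs_of_nonneg hp0]
    refine mul_le_mul_of_nonneg_left ?_ hp0
    -- Replacing `q₁` by the law `Γ w` induced by the bin turns the encoder's output into the plain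
    -- codebook average, by `e3`.
    have e : q₁ s * outputLaw Q B F s₀ s v - q₂ s v
        = (M : ℝ)⁻¹ * ∑ w, (q₁ s - Γ w s) * m w s v
          + ((M : ℝ)⁻¹ * ∑ w, Γ w s * m w s v - q₂ s v) := by
      rw [outputLaw_eq, ← Finset.mul_sum]
      simp_rw [sub_mul, Finset.sum_sub_distrib, ← Finset.mul_sum]
      ring
    rw [e]
    refine (abs_add_le _ _).trans (add_le_add ?_ le_rfl)
    rw [abs_mul, abs_of_nonneg (by positivity : (0 : ℝ) ≤ (M : ℝ)⁻¹)]
    refine mul_le_mul_of_nonneg_left ?_ (by positivity)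
    refine (Finset.abs_sum_le_sum_abs _ _).trans (Finset.sum_le_sum fun w _ => ?_)
    rw [abs_mul, abs_of_nonneg (hm0 w s v), abs_sub_comm]
  simp only [e1, e2]
  refine (Finset.sum_le_sum fun s _ => Finset.sum_le_sum fun v _ => hpt s v).trans ?_
  simp_rw [← Finset.mul_sum, Finset.sum_add_distrib, e4, e5]
  refine mul_le_mul_of_nonneg_left (add_le_add ?_ le_rfl) hp0
  simp_rw [← Finset.mul_sum]
  refine mul_le_mul_of_nonneg_left ?_ (by positivity)
  rw [Finset.sum_comm (s := (Finset.univ : Finset (Fin M)))]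
  refine Finset.sum_le_sum fun s _ => ?_
  rw [Finset.sum_comm]
  refine Finset.sum_le_sum fun w _ => ?_
  rw [← Finset.mul_sum]
  exact mul_le_of_le_one_right (abs_nonneg _) (hm1 w s)

end Output

/-! ### Averaging over the random codebook. -/

section Expectation

variable {S₀ S U V : Type*} [Fintype S₀] [Fintype S] [Fintype U] [Fintype V] [DecidableEq S₀]
  {n M K : ℕ} {Q : S₀ × S × U × V → ℝ}

lemma codebookLaw_nonneg (hQ : ∀ x, 0 ≤ Q x) (B : Codebook S₀ U n M K) : 0 ≤ codebookLaw Q B :=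
  Finset.prod_nonneg fun _ _ => Finset.prod_nonneg fun _ _ => Finset.prod_nonneg fun _ _ =>
    Finset.prod_nonneg fun _ _ => kerU_nonneg hQ _ _

/-- Restricting to codebooks of positive law matters: absolute continuity is only available for
those. -/
lemma codebookExp_mono (hQ : ∀ x, 0 ≤ Q x) {f g : Codebook S₀ U n M K → ℝ}
    (h : ∀ B, 0 < codebookLaw Q B → f B ≤ g B) : codebookExp Q f ≤ codebookExp Q g := by
  refine Finset.sum_le_sum fun B _ => ?_
  rcases (codebookLaw_nonneg hQ B).eq_or_lt' with h0 | h0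
  · simp [h0]
  · exact mul_le_mul_of_nonneg_left (h B h0) h0.le

lemma abs_codebookExp_le (hQ : ∀ x, 0 ≤ Q x) (f : Codebook S₀ U n M K → ℝ) :
    |codebookExp Q f| ≤ codebookExp Q fun B => |f B| := by
  refine (Finset.abs_sum_le_sum_abs _ _).trans (le_of_eq ?_)
  exact Finset.sum_congr rfl fun B _ => by
    rw [abs_mul, abs_of_nonneg (codebookLaw_nonneg hQ B)]

lemma codebookExp_mul_left (c : ℝ) (f : Codebook S₀ U n M K → ℝ) :
    codebookExp Q (fun B => c * f B) = c * codebookExp Q f := by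
  simp only [codebookExp]
  rw [Finset.mul_sum]
  exact Finset.sum_congr rfl fun B _ => by ring

lemma codebookExp_add (f g : Codebook S₀ U n M K → ℝ) :
    codebookExp Q (fun B => f B + g B) = codebookExp Q f + codebookExp Q g := by
  simp only [codebookExp, mul_add, Finset.sum_add_distrib]

lemma codebookExp_sum {ι : Type*} (s : Finset ι) (f : ι → Codebook S₀ U n M K → ℝ) :
    codebookExp Q (fun B => ∑ i ∈ s, f i B) = ∑ i ∈ s, codebookExp Q (f i) := by
  simp only [codebookExp, Finset.mul_sum]
  exact Finset.sum_comm

lemma prodKernel_kerU_sum (hQ : Q ∈ stdSimplex ℝ (S₀ × S × U × V)) (s₀ : Fin n → S₀) :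
    ∑ u : Fin n → U, prodKernel (kerU Q) s₀ u = 1 :=
  sum_pi_prod_eq_one (P := fun t => kerU Q (s₀ t)) fun t => (isChain_kerS hQ).a_sum (s₀ t)

/-- The codewords attached to `s₀` form a random codebook by themselves. -/
lemma codebookExp_row (hQ : Q ∈ stdSimplex ℝ (S₀ × S × U × V)) (s₀ : Fin n → S₀)
    (g : (Fin M → Fin K → Fin n → U) → ℝ) :
    codebookExp Q (fun B : Codebook S₀ U n M K => g (B s₀))
      = ∑ r : Fin M → Fin K → Fin n → U, (∏ w, ∏ i, prodKernel (kerU Q) s₀ (r w i)) * g r :=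
  sum_pi_prod_mul_eval
    (P := fun s₀ (r : Fin M → Fin K → Fin n → U) => ∏ w, ∏ i, prodKernel (kerU Q) s₀ (r w i))
    (fun s₀ => sum_pi_prod_eq_one
      (P := fun _ (b : Fin K → Fin n → U) => ∏ i, prodKernel (kerU Q) s₀ (b i))
      fun _ => sum_pi_prod_eq_one (P := fun _ => prodKernel (kerU Q) s₀)
        fun _ => prodKernel_kerU_sum hQ s₀) s₀ g

lemma codebookExp_bin (hQ : Q ∈ stdSimplex ℝ (S₀ × S × U × V)) (s₀ : Fin n → S₀) (w : Fin M)
    (g : (Fin K → Fin n → U) → ℝ) :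
    codebookExp Q (fun B : Codebook S₀ U n M K => g (B s₀ w))
      = ∑ b : Fin K → Fin n → U, (∏ i, prodKernel (kerU Q) s₀ (b i)) * g b := by
  rw [codebookExp_row hQ s₀ fun r => g (r w)]
  exact sum_pi_prod_mul_eval
    (P := fun _ (b : Fin K → Fin n → U) => ∏ i, prodKernel (kerU Q) s₀ (b i))
    (fun _ => sum_pi_prod_eq_one (P := fun _ => prodKernel (kerU Q) s₀)
        fun _ => prodKernel_kerU_sum hQ s₀) w g

/-- Given `s₀`, one bin is a codebook of `K` independent words for the channel `kerS`. -/
lemma exists_binDeviation_rate (hQ : Q ∈ stdSimplex ℝ (S₀ × S × U × V)) {R : ℝ}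
    (hR : infoUS Q < R) :
    ∃ ρ : ℝ, 0 < ρ ∧ ρ < 1 ∧ ∀ n M K : ℕ, (2 : ℝ) ^ ((n : ℝ) * R) ≤ 4 * K → ∀ w : Fin M,
      ∑ s₀ : Fin n → S₀, (∏ t, margS₀ Q (s₀ t)) *
        codebookExp Q (fun B : Codebook S₀ U n M K => binDeviation Q s₀ (B s₀ w)) ≤ 4 * ρ ^ n := by
  rw [infoUS_eq hQ] at hR
  obtain ⟨ρ, h0, h1, h⟩ := (isChain_kerS hQ).exists_covering_rate hR
  refine ⟨ρ, h0, h1, fun n M K hK w => ?_⟩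
  have := h n (Fin K) (by rwa [Fintype.card_fin])
  rw [Fintype.card_fin] at this
  simp_rw [codebookExp_bin hQ]
  exact this

/-- Given `s₀`, all bins together form a codebook of `M * K` independent words for the channel
`kerSV`; the rest is currying and regrouping pairs of sequences. -/
lemma exists_rowDeviation_rate (hQ : Q ∈ stdSimplex ℝ (S₀ × S × U × V)) {R : ℝ}
    (hR : infoUSV Q < R) :
    ∃ ρ : ℝ, 0 < ρ ∧ ρ < 1 ∧ ∀ n M K : ℕ, (2 : ℝ) ^ ((n : ℝ) * R) ≤ 4 * (M * K) →
      ∑ s₀ : Fin n → S₀, (∏ t, margS₀ Q (s₀ t)) *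
        codebookExp Q (fun B : Codebook S₀ U n M K => rowDeviation Q s₀ (B s₀)) ≤ 4 * ρ ^ n := by
  rw [infoUSV_eq hQ] at hR
  obtain ⟨ρ, h0, h1, h⟩ := (isChain_kerSV hQ).exists_covering_rate hR
  refine ⟨ρ, h0, h1, fun n M K hK => ?_⟩
  have := h n (Fin M × Fin K) (by
    rw [Fintype.card_prod, Fintype.card_fin, Fintype.card_fin]; exact_mod_cast hK)
  refine le_trans (le_of_eq ?_) this
  refine Finset.sum_congr rfl fun s₀ _ => ?_
  congr 1
  rw [codebookExp_row hQ s₀ fun r => rowDeviation Q s₀ r,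
    ← (Equiv.curry (Fin M) (Fin K) (Fin n → U)).sum_comp]
  refine Finset.sum_congr rfl fun r _ => ?_
  congr 1
  · rw [Fintype.prod_prod_type]; rfl
  · rw [← (Equiv.arrowProdEquivProdArrow (Fin n) (fun _ => S) (fun _ => V)).symm.sum_comp,
      Fintype.sum_prod_type]
    refine Finset.sum_congr rfl fun s _ => Finset.sum_congr rfl fun v _ => ?_
    rw [Fintype.card_prod, Fintype.card_fin, Fintype.card_fin, Fintype.sum_prod_type,
      ← Finset.mul_sum, ← mul_assoc, Nat.cast_mul, mul_inv]
    rfl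

/-- For `x ≥ 1` the floor is at least 1, so `x < ⌊x⌋ + 1 ≤ 2⌊x⌋`. Two such losses make the 4 in the
covering hypothesis. -/
lemma two_rpow_le_two_mul_numIdx {R : ℝ} (hR : 0 ≤ R) (n : ℕ) :
    (2 : ℝ) ^ ((n : ℝ) * R) ≤ 2 * numIdx n R := by
  have h1 : (1 : ℝ) ≤ (2 : ℝ) ^ ((n : ℝ) * R) :=
    Real.one_le_rpow one_le_two (by positivity)
  have h2 : (1 : ℝ) ≤ numIdx n R := by
    exact_mod_cast Nat.le_floor (by simpa using h1)
  have h3 := Nat.lt_floor_add_one ((2 : ℝ) ^ ((n : ℝ) * R))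
  unfold numIdx at *
  linarith

/-- The expected total variation decays exponentially, uniformly over the completions. -/
theorem exists_jointTV_rate (hQ : Q ∈ stdSimplex ℝ (S₀ × S × U × V)) {Rt R' : ℝ} (hRt : 0 ≤ Rt)
    (hR' : 0 ≤ R') (h1 : infoUS Q < R') (h2 : infoUSV Q < R' + Rt) :
    ∃ ρ : ℝ, 0 < ρ ∧ ρ < 1 ∧ ∀ F : ∀ n : ℕ, Codebook S₀ U n (numIdx n Rt) (numIdx n R') →
        Fin (numIdx n Rt) → (Fin n → S₀) → (Fin n → S) → (Fin n → V) → ℝ,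
      IsCompletion Rt R' F → ∀ n : ℕ,
        codebookExp Q (fun B => jointTV Q (outputLaw Q B (F n B))) ≤ 4 * ρ ^ n := by
  obtain ⟨ρ₁, a0, a1, ha⟩ := exists_binDeviation_rate hQ h1
  obtain ⟨ρ₂, b0, b1, hb⟩ := exists_rowDeviation_rate hQ h2
  refine ⟨max ρ₁ ρ₂, lt_max_of_lt_left a0, max_lt a1 b1, fun F hF n => ?_⟩
  set M := numIdx n Rt with hM
  set K := numIdx n R' with hK
  have hK2 := two_rpow_le_two_mul_numIdx hR' n
  have hM2 := two_rpow_le_two_mul_numIdx hRt n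
  rw [← hK] at hK2
  rw [← hM] at hM2
  have hM0 : (0 : ℝ) < M := by
    have := Real.rpow_pos_of_pos (two_pos (α := ℝ)) ((n : ℝ) * Rt)
    linarith
  have hMK : (2 : ℝ) ^ ((n : ℝ) * (R' + Rt)) ≤ 4 * (M * K) := by
    rw [mul_add, Real.rpow_add two_pos]
    refine (mul_le_mul hK2 hM2 (by positivity) (by positivity)).trans (le_of_eq (by ring))
  have hpt := codebookExp_mono (Q := Q) hQ.1
    (f := fun B : Codebook S₀ U n M K => 2 * jointTV Q (outputLaw Q B (F n B)))
    fun B _ => two_mul_jointTV_le (B := B) hQ (fun w s₀ s v => (hF n B w s₀ s).1 v)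
      fun w s₀ s => (hF n B w s₀ s).2
  rw [codebookExp_mul_left, codebookExp_sum] at hpt
  simp_rw [codebookExp_mul_left, codebookExp_add, codebookExp_mul_left, codebookExp_sum, mul_add,
    Finset.sum_add_distrib] at hpt
  have e : ∑ s₀ : Fin n → S₀, (∏ t, margS₀ Q (s₀ t)) * ((M : ℝ)⁻¹ * ∑ w : Fin M,
      codebookExp Q (fun B : Codebook S₀ U n M K => binDeviation Q s₀ (B s₀ w)))
      = (M : ℝ)⁻¹ * ∑ w : Fin M, ∑ s₀ : Fin n → S₀, (∏ t, margS₀ Q (s₀ t)) *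
        codebookExp Q (fun B : Codebook S₀ U n M K => binDeviation Q s₀ (B s₀ w)) := by
    rw [Finset.sum_comm, Finset.mul_sum]
    simp_rw [mul_left_comm _ (M : ℝ)⁻¹, ← Finset.mul_sum]
  have h4 : (M : ℝ)⁻¹ * ∑ w : Fin M, ∑ s₀ : Fin n → S₀, (∏ t, margS₀ Q (s₀ t)) *
        codebookExp Q (fun B : Codebook S₀ U n M K => binDeviation Q s₀ (B s₀ w))
      ≤ 4 * ρ₁ ^ n := by
    rw [inv_mul_le_iff₀ hM0]
    refine (Finset.sum_le_sum fun w _ => ha n M K (by linarith) w).trans ?_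
    simp
  rw [e] at hpt
  have h5 := hb n M K hMK
  have m1 : ρ₁ ^ n ≤ (max ρ₁ ρ₂) ^ n := pow_le_pow_left₀ a0.le (le_max_left _ _) n
  have m2 : ρ₂ ^ n ≤ (max ρ₁ ρ₂) ^ n := pow_le_pow_left₀ b0.le (le_max_right _ _) n
  linarith

end Expectation

/-! ### From total variation to relative entropy. -/

section RelativeEntropy

/-- For `T ≤ P`, split `P = (P - T) + T`: the log is at most `D` on the first part because `P ≤ 1`,
and `log x ≤ x - 1` handles the second. For `P ≤ T`, `log x ≤ x - 1` alone gives `T - P`. -/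
lemma abs_mul_log_div_le {P T D : ℝ} (hP : 0 ≤ P) (hP1 : P ≤ 1) (hT : 0 ≤ T) (hD : 0 ≤ D)
    (hPT : T = 0 → P = 0) (hTD : 0 < T → -Real.log T ≤ D) :
    |P * Real.log (P / T)| ≤ |P - T| * (1 + D) := by
  rcases hP.eq_or_lt' with rfl | hP0
  · rw [zero_mul, abs_zero]; positivity
  have hT0 : 0 < T := hT.lt_of_ne' fun h => hP0.ne' (hPT h)
  rcases le_total T P with h | h
  · have h1 : 1 ≤ P / T := (one_le_div hT0).mpr h
    have hl0 : 0 ≤ Real.log (P / T) := Real.log_nonneg h1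
    have hlD : Real.log (P / T) ≤ D := by
      rw [Real.log_div hP0.ne' hT0.ne']
      linarith [hTD hT0, Real.log_nonpos hP hP1]
    have hl1 := Real.log_le_sub_one_of_pos (div_pos hP0 hT0)
    have h2 : T * Real.log (P / T) ≤ P - T := by
      refine (mul_le_mul_of_nonneg_left hl1 hT).trans (le_of_eq ?_)
      field_simp
    rw [abs_of_nonneg (mul_nonneg hP hl0), abs_of_nonneg (sub_nonneg.mpr h)]
    nlinarith [mul_le_mul_of_nonneg_left hlD (sub_nonneg.mpr h)]
  · have h1 : P / T ≤ 1 := (div_le_one hT0).mpr h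
    have hl0 : Real.log (P / T) ≤ 0 := Real.log_nonpos (by positivity) h1
    have hl1 := Real.log_le_sub_one_of_pos (div_pos hT0 hP0)
    have h2 : P * Real.log (T / P) ≤ T - P := by
      refine (mul_le_mul_of_nonneg_left hl1 hP).trans (le_of_eq ?_)
      field_simp
    have h3 : Real.log (T / P) = -Real.log (P / T) := by rw [← Real.log_inv, inv_div]
    rw [abs_of_nonpos (mul_nonpos_of_nonneg_of_nonpos hP hl0),
      abs_of_nonpos (sub_nonpos.mpr h)]
    rw [h3] at h2
    nlinarith [mul_nonneg (sub_nonneg.mpr h) hD]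

variable {S₀ S U V : Type*} [Fintype S₀] [Fintype S] [Fintype U] [Fintype V]
  {n : ℕ} {Q : S₀ × S × U × V → ℝ}

/-- A bound on the logarithms of the target kernel. -/
noncomputable def logBound (Q : S₀ × S × U × V → ℝ) : ℝ := ∑ x, ∑ v, |Real.log (targetV Q x v)|

lemma logBound_nonneg (Q : S₀ × S × U × V → ℝ) : 0 ≤ logBound Q :=
  Finset.sum_nonneg fun _ _ => Finset.sum_nonneg fun _ _ => abs_nonneg _

lemma neg_log_targetV_le (Q : S₀ × S × U × V → ℝ) (x : S₀ × S) (v : V) :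
    -Real.log (targetV Q x v) ≤ logBound Q :=
  (neg_le_abs _).trans <|
    (Finset.single_le_sum (f := fun v => |Real.log (targetV Q x v)|) (fun _ _ => abs_nonneg _)
      (Finset.mem_univ v)).trans
    (Finset.single_le_sum (f := fun x => ∑ v, |Real.log (targetV Q x v)|)
      (fun _ _ => Finset.sum_nonneg fun _ _ => abs_nonneg _) (Finset.mem_univ x))

lemma neg_log_prodKernel_targetV_le {x : Fin n → S₀ × S} {v : Fin n → V}
    (h : 0 < prodKernel (targetV Q) x v) :
    -Real.log (prodKernel (targetV Q) x v) ≤ n * logBound Q := by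
  rw [prodKernel] at h ⊢
  rw [Real.log_prod (fun t ht => Finset.prod_ne_zero_iff.mp h.ne' t ht), ← Finset.sum_neg_distrib]
  refine (Finset.sum_le_sum fun t _ => neg_log_targetV_le Q (x t) (v t)).trans ?_
  simp

/-- Total variation controls the relative entropy to a memoryless target. -/
lemma abs_condRelEntropy_le (hQ : ∀ x, 0 ≤ Q x)
    {P : (Fin n → S₀) → (Fin n → S) → (Fin n → V) → ℝ} (hP : ∀ s₀ s v, 0 ≤ P s₀ s v)
    (hP1 : ∀ s₀ s v, P s₀ s v ≤ 1)
    (hac : ∀ s₀ s v, 0 < prodPMF (margS₀S Q) (fun t => (s₀ t, s t)) →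
      prodKernel (targetV Q) (fun t => (s₀ t, s t)) v = 0 → P s₀ s v = 0) :
    |condRelEntropy Q P| ≤ 2 * (1 + n * logBound Q) / Real.log 2 * jointTV Q P := by
  have hlog2 : 0 < Real.log 2 := Real.log_pos one_lt_two
  have e : 2 * (1 + n * logBound Q) / Real.log 2 * jointTV Q P
      = ∑ s₀ : Fin n → S₀, ∑ s : Fin n → S, ∑ v : Fin n → V,
        |prodPMF (margS₀S Q) (fun t => (s₀ t, s t)) * P s₀ s v
          - prodPMF (margS₀SV Q) (fun t => (s₀ t, s t, v t))|
        * ((1 + n * logBound Q) / Real.log 2) := by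
    unfold jointTV tvDist
    simp_rw [Fintype.sum_prod_type, ← Finset.sum_mul]
    ring
  rw [e]
  refine (Finset.abs_sum_le_sum_abs _ _).trans (Finset.sum_le_sum fun s₀ _ => ?_)
  refine (Finset.abs_sum_le_sum_abs _ _).trans (Finset.sum_le_sum fun s _ => ?_)
  rw [relEntropy, Finset.mul_sum]
  refine (Finset.abs_sum_le_sum_abs _ _).trans (Finset.sum_le_sum fun v _ => ?_)
  set m := prodPMF (margS₀S Q) (fun t => (s₀ t, s t)) with hm
  set T := prodKernel (targetV Q) (fun t => (s₀ t, s t)) v with hT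
  have e2 : prodPMF (margS₀SV Q) (fun t => (s₀ t, s t, v t)) = m * T := by
    rw [hm, hT, prodPMF, prodPMF, prodKernel, ← Finset.prod_mul_distrib]
    exact Finset.prod_congr rfl fun t _ => (margS₀S_mul_targetV hQ (s₀ t, s t) (v t)).symm
  have hm0 : 0 ≤ m := Finset.prod_nonneg fun t _ =>
    Finset.sum_nonneg fun _ _ => Finset.sum_nonneg fun _ _ => hQ _
  have hT0 : 0 ≤ T := Finset.prod_nonneg fun t _ => targetV_nonneg hQ _ _
  rw [e2, ← mul_sub, abs_mul, abs_mul m, abs_of_nonneg hm0, mul_assoc]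
  rcases hm0.eq_or_lt' with h0 | h0
  · rw [h0, zero_mul, zero_mul]
  refine mul_le_mul_of_nonneg_left ?_ hm0
  have := abs_mul_log_div_le (hP s₀ s v) (hP1 s₀ s v) hT0
    (mul_nonneg (Nat.cast_nonneg n) (logBound_nonneg Q)) (hac s₀ s v h0)
    neg_log_prodKernel_targetV_le
  rw [Real.logb, ← mul_div_assoc, abs_div, abs_of_pos hlog2, ← mul_div_assoc]
  exact div_le_div_of_nonneg_right this hlog2.le

end RelativeEntropy

/-- A linear factor is absorbed by an exponential. -/
lemma eventually_linear_mul_pow_le (a b : ℝ) {σ : ℝ} (h0 : 0 ≤ σ) (h1 : σ < 1) :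
    ∀ᶠ n : ℕ in atTop, (a + n * b) * (σ ^ 2) ^ n ≤ σ ^ n := by
  have ht : Tendsto (fun n : ℕ => a * σ ^ n + b * ((n : ℝ) * σ ^ n)) atTop (𝓝 (a * 0 + b * 0)) :=
    ((tendsto_pow_atTop_nhds_zero_of_lt_one h0 h1).const_mul a).add
      ((tendsto_self_mul_const_pow_of_lt_one h0 h1).const_mul b)
  rw [mul_zero, mul_zero, add_zero] at ht
  filter_upwards [ht.eventually (gt_mem_nhds one_pos)] with n hn
  have e : (a + n * b) * (σ ^ 2) ^ n = (a * σ ^ n + b * ((n : ℝ) * σ ^ n)) * σ ^ n := by ring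
  rw [e]
  exact mul_le_of_le_one_left (pow_nonneg h0 n) hn.le

end SoftCovering

/-! ### Choice of the exponent and conclusion. -/

open SoftCovering in
theorem lemma1 {S₀ S U V : Type*} [Fintype S₀] [Fintype S] [Fintype U] [Fintype V]
    [DecidableEq S₀]
    (Q : S₀ × S × U × V → ℝ) (hQ : Q ∈ stdSimplex ℝ (S₀ × S × U × V))
    (Rt R' : ℝ) (hRt : 0 ≤ Rt) (hR' : 0 ≤ R')
    (h1 : infoUS Q < R') (h2 : infoUSV Q < R' + Rt) :
    ∃ c : ℝ, 0 < c ∧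
      ∀ F : ∀ n : ℕ, Codebook S₀ U n (numIdx n Rt) (numIdx n R') →
          Fin (numIdx n Rt) → (Fin n → S₀) → (Fin n → S) → (Fin n → V) → ℝ,
        IsCompletion Rt R' F →
        -- the expected total variation decays exponentially
        (∀ᶠ n : ℕ in atTop,
          codebookExp Q (fun B => jointTV Q (outputLaw Q B (F n B))) ≤ Real.exp (-c * n)) ∧
        -- if the completion never leaves the support of the target,
        -- then the expected relative entropy is finite and tends to zero (exponentially fast)
        ((∀ n B w s₀ s v, 0 < prodPMF (margS₀S Q) (fun t => (s₀ t, s t)) →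
            prodKernel (targetV Q) (fun t => (s₀ t, s t)) v = 0 → F n B w s₀ s v = 0) →
          (∀ n (B : Codebook S₀ U n (numIdx n Rt) (numIdx n R')), 0 < codebookLaw Q B →
            ∀ s₀ s v, 0 < prodPMF (margS₀S Q) (fun t => (s₀ t, s t)) →
              prodKernel (targetV Q) (fun t => (s₀ t, s t)) v = 0 →
              outputLaw Q B (F n B) s₀ s v = 0) ∧
          Tendsto (fun n : ℕ =>
            codebookExp Q (fun B : Codebook S₀ U n (numIdx n Rt) (numIdx n R') =>
              condRelEntropy Q (outputLaw Q B (F n B)))) atTop (𝓝 0) ∧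
          ∀ᶠ n : ℕ in atTop,
            |codebookExp Q (fun B : Codebook S₀ U n (numIdx n Rt) (numIdx n R') =>
              condRelEntropy Q (outputLaw Q B (F n B)))| ≤ Real.exp (-c * n)) := by
  obtain ⟨ρ, hρ0, hρ1, hρ⟩ := exists_jointTV_rate hQ hRt hR' h1 h2
  -- Since `ρ = σ ^ 2`, one factor `σ ^ n` absorbs the constants and the linear term while the other
  -- remains as the bound; `c = -log σ` depends only on `ρ`, hence not on `F`.
  set σ := Real.sqrt ρ with hσ
  have hσ0 : 0 < σ := Real.sqrt_pos.mpr hρ0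
  have hσ1 : σ < 1 := by rw [hσ, Real.sqrt_lt' one_pos]; simpa using hρ1
  have hσ2 : σ ^ 2 = ρ := Real.sq_sqrt hρ0.le
  have hexp : ∀ n : ℕ, Real.exp (-(-Real.log σ) * n) = σ ^ n := fun n => by
    rw [neg_neg, mul_comm, Real.exp_nat_mul, Real.exp_log hσ0]
  refine ⟨-Real.log σ, neg_pos.mpr (Real.log_neg hσ0 hσ1), fun F hF => ⟨?_, fun hFs => ?_⟩⟩
  · filter_upwards [eventually_linear_mul_pow_le 4 0 hσ0.le hσ1] with n hn
    rw [hexp]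
    rw [mul_zero, add_zero, hσ2] at hn
    exact (hρ F hF n).trans hn
  have hac : ∀ n (B : Codebook S₀ U n (numIdx n Rt) (numIdx n R')), 0 < codebookLaw Q B →
      ∀ s₀ s v, 0 < prodPMF (margS₀S Q) (fun t => (s₀ t, s t)) →
        prodKernel (targetV Q) (fun t => (s₀ t, s t)) v = 0 →
        outputLaw Q B (F n B) s₀ s v = 0 := fun n B hB s₀ s v hs hv =>
    outputLaw_eq_zero hQ.1 hB hs hv fun w => hFs n B w s₀ s v hs hv
  have hbound : ∀ᶠ n : ℕ in atTop,
      |codebookExp Q (fun B : Codebook S₀ U n (numIdx n Rt) (numIdx n R') =>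
        condRelEntropy Q (outputLaw Q B (F n B)))| ≤ σ ^ n := by
    filter_upwards [eventually_linear_mul_pow_le (8 / Real.log 2) (8 * logBound Q / Real.log 2)
      hσ0.le hσ1] with n hn
    have hlog2 : 0 < Real.log 2 := Real.log_pos one_lt_two
    have hle := codebookExp_mono (Q := Q) hQ.1
      (f := fun B : Codebook S₀ U n (numIdx n Rt) (numIdx n R') =>
        |condRelEntropy Q (outputLaw Q B (F n B))|)
      fun B hB => abs_condRelEntropy_le hQ.1
        (outputLaw_nonneg hQ.1 fun w s₀ s v => (hF n B w s₀ s).1 v)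
        (outputLaw_le_one hQ (fun w s₀ s v => (hF n B w s₀ s).1 v)
          fun w s₀ s => (hF n B w s₀ s).2) (hac n B hB)
    rw [codebookExp_mul_left] at hle
    refine (abs_codebookExp_le hQ.1 _).trans (hle.trans (le_trans ?_ hn))
    refine (mul_le_mul_of_nonneg_left (hρ F hF n) ?_).trans (le_of_eq ?_)
    · have := logBound_nonneg Q
      positivity
    · rw [hσ2]; ring
  refine ⟨hac, ?_, ?_⟩
  · exact squeeze_zero_norm' (by simpa only [Real.norm_eq_abs] using hbound)
      (tendsto_pow_atTop_nhds_zero_of_lt_one hσ0.le hσ1)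
  · filter_upwards [hbound] with n hn
    rw [hexp]
    exact hn
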